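/- Let $m,n\ge 1$ be integers with $\gcd(m,n)=1$, put $d=m+n$, and let $A\in \mathrm{Mat}_{m\times n}(\mathbb{R})$. Fix arbitrary norms $\|\cdot\|$ on $\mathbb{R}^m$ and on $\mathbb{R}^n$; for $x\in\mathbb{T}^m=\mathbb{R}^m/\mathbb{Z}^m$ let $\langle x\rangle$ be the smallest norm of a representative of $x$ in $\mathbb{R}^m$, and for $v\in\mathbb{R}^m$ write $\langle v\rangle$ for $\langle v+\mathbb{Z}^m\rangle$. Let $$\mathrm{Bad}_A=\Big\{\eta\in\mathbb{T}^m:\ \liminf_{q\in\mathbb{Z}^n,\ \|q\|\to\infty}\|q\|^{n/m}\langle Aq-\eta\rangle>0\Big\},$$ where the lower limit is taken in $[0,\infty]$. A non-trivial algebraic measure on $\mathbb{T}^m$ is a probability measure $\mu$ for which there is a linear subspace $U\neq\{0\}$ of $\mathbb{R}^m$ with closed image in $\mathbb{T}^m$ such that $\mu$ is $U$-invariant and supported on a single $U$-orbit in $\mathbb{T}^m$. Let $X=\mathrm{SL}_d(\mathbb{R})/\mathrm{SL}_d(\mathbb{Z})$ be the space of unimodular lattices in $\mathbb{R}^d$ with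 the quotient topology, let $h_t=\mathrm{diag}(e^{nt}I_m,e^{-mt}I_n)\in \mathrm{SL}_d(\mathbb{R})$, and let $x_A=\begin{pmatrix} I_m&A\\0&I_n\end{pmatrix}\mathbb{Z}^d\in X$. For $x\in X$ let $\partial(x)$ be the set of all $y\in X$ such that $h_{t_k}x\to y$ for some unbounded sequence $(t_k)$ in $\mathbb{R}_{\ge0}$. An accumulation sequence of length $k+1$ for $x$ is a tuple $(x_0,\dots,x_k)\in X^{k+1}$ with $x_0=x$ and $x_{i+1}\in\partial(x_i)$ for $0\le i<k$. The matrix $A$ is called $k$-divergent if $k$ is the supremum of $\mathrm{length}(I)-1$ over all accumulation sequences $I$ for $x_A$. Assume that $A$ is not $k$-divergent for any integer $0\le k\le d-2$. Then both of the following hold. 1. $\mu(\mathrm{Bad}_A)=0$ for every non-trivial algebraic measure $\mu$ on $\mathbb{T}^m$. 2. For every non-zero $p_0\in\mathbb{Z}^m$ and every $\eta\in\mathbb{R}^m$, for Lebesgue-almost every $t\in\mathbb{R}$, $$\liminf_{q\in\mathbb{Z}^n,\ \|q\|\to\infty}\|q\|^{n/m}\langle Aq-(tp_0+\eta)\rangle=0.$$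 -/

import Mathlib

open Filter Topology MeasureTheory
open scoped ENNReal

noncomputable section

namespace InhomApprox

/-! ### The torus, the induced distance, and badly approximable targets -/

/-- The quotient map `ℝ^m → 𝕋^m = ℝ^m / ℤ^m`. -/
def toTorus {m : ℕ} (v : Fin m → ℝ) : UnitAddTorus (Fin m) := fun i => (v i : UnitAddCircle)

/-- An integral vector seen as a real vector. -/
def intVec {k : ℕ} (q : Fin k → ℤ) : Fin k → ℝ := fun i => (q i : ℝ)

/-- The distance `⟨x⟩` from `x ∈ 𝕋^m` to `0` induced by a norm `N` on `ℝ^m`: the smallest norm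
of a representative of `x`. -/
def torusDist {m : ℕ} (N : Seminorm ℝ (Fin m → ℝ)) (x : UnitAddTorus (Fin m)) : ℝ :=
  sInf (N '' {v : Fin m → ℝ | toTorus v = x})

/-- The filter `‖q‖ → ∞` on `ℤ^n`. -/
def normAtTop {n : ℕ} (N : Seminorm ℝ (Fin n → ℝ)) : Filter (Fin n → ℤ) :=
  Filter.comap (fun q => N (intVec q)) atTop

/-- `liminf_{q ∈ ℤ^n, ‖q‖ → ∞} ‖q‖^{n/m} ⟨A q - η⟩`, with values in `[0, ∞]` (the terms are
non-negative, and the lower limit may be infinite). -/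
def approxLiminf {m n : ℕ} (Nm : Seminorm ℝ (Fin m → ℝ)) (Nn : Seminorm ℝ (Fin n → ℝ))
    (A : Matrix (Fin m) (Fin n) ℝ) (η : UnitAddTorus (Fin m)) : ℝ≥0∞ :=
  Filter.liminf
    (fun q : Fin n → ℤ => ENNReal.ofReal
      (Nn (intVec q) ^ ((n : ℝ) / (m : ℝ)) * torusDist Nm (toTorus (A.mulVec (intVec q)) - η)))
    (normAtTop Nn)

/-- The set `Bad_A ⊆ 𝕋^m` of badly approximable targets for `A`. -/
def Bad {m n : ℕ} (Nm : Seminorm ℝ (Fin m → ℝ)) (Nn : Seminorm ℝ (Fin n → ℝ))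
    (A : Matrix (Fin m) (Fin n) ℝ) : Set (UnitAddTorus (Fin m)) :=
  {η | 0 < approxLiminf Nm Nn A η}

/-- `μ` is a non-trivial algebraic measure on `𝕋^m`: a probability measure for which there is a
non-zero subspace `U` of `ℝ^m` with closed image in `𝕋^m`, such that `μ` is `U`-invariant and
supported on a single `U`-orbit. -/
def IsNontrivialAlgebraic {m : ℕ} (μ : Measure (UnitAddTorus (Fin m))) : Prop :=
  IsProbabilityMeasure μ ∧
  ∃ U : Submodule ℝ (Fin m → ℝ), U ≠ ⊥ ∧ IsClosed (toTorus '' (U : Set (Fin m → ℝ))) ∧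
    (∀ u ∈ U, Measure.map (fun y => toTorus u + y) μ = μ) ∧
    ∃ x : UnitAddTorus (Fin m), μ ({y | ∃ u ∈ U, y = toTorus u + x}ᶜ) = 0

/-! ### The space of unimodular lattices, the flow, and `k`-divergence -/

/-- `SL_d(ℝ)` with `d = m + n`; coordinates are split as `ℝ^d = ℝ^m ⊕ ℝ^n`. -/
abbrev G (m n : ℕ) : Type := Matrix.SpecialLinearGroup (Fin m ⊕ Fin n) ℝ

/-- `SL_d(ℤ)` as a subgroup of `SL_d(ℝ)`. -/
abbrev Γ (m n : ℕ) : Subgroup (G m n) :=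
  (Matrix.SpecialLinearGroup.map (n := Fin m ⊕ Fin n) (Int.castRingHom ℝ)).range

/-- The space `X = SL_d(ℝ) / SL_d(ℤ)` of unimodular lattices in `ℝ^d`, with the quotient topology
and the left action of `SL_d(ℝ)`; the coset of `g` is the lattice `g ℤ^d`. -/
abbrev LatticeSpace (m n : ℕ) : Type := G m n ⧸ Γ m n

/-- The unipotent matrix with blocks `I_m, A, 0, I_n`. -/
def unip {m n : ℕ} (A : Matrix (Fin m) (Fin n) ℝ) : G m n :=
  ⟨Matrix.fromBlocks 1 A 0 1, by simp⟩

/-- The lattice `x_A`. -/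
def latticeOf {m n : ℕ} (A : Matrix (Fin m) (Fin n) ℝ) : LatticeSpace m n :=
  QuotientGroup.mk (unip A)

/-- The block diagonal matrix `h_t = diag(e^{nt} I_m, e^{-mt} I_n)`. -/
def flow (m n : ℕ) (t : ℝ) : G m n :=
  ⟨Matrix.fromBlocks (Real.exp ((n : ℝ) * t) • (1 : Matrix (Fin m) (Fin m) ℝ)) 0 0
      (Real.exp (-((m : ℝ) * t)) • (1 : Matrix (Fin n) (Fin n) ℝ)), by
    rw [Matrix.det_fromBlocks_zero₂₁, Matrix.det_smul, Matrix.det_smul, Matrix.det_one,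
      Matrix.det_one, mul_one, mul_one, Fintype.card_fin, Fintype.card_fin, ← Real.exp_nat_mul,
      ← Real.exp_nat_mul, ← Real.exp_add, Real.exp_eq_one_iff]
    ring⟩

/-- The set `∂(x)` of asymptotic accumulation points of `x`. -/
def asymptoticAcc {m n : ℕ} (x : LatticeSpace m n) : Set (LatticeSpace m n) :=
  {y | ∃ t : ℕ → ℝ, (∀ k, 0 ≤ t k) ∧ ¬ BddAbove (Set.range t) ∧
    Tendsto (fun k => flow m n (t k) • x) atTop (𝓝 y)}

/-- `I = (x_0, …, x_k)` is an accumulation sequence (of length `k + 1`) for `x`. -/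
def IsAccSeq {m n : ℕ} (x : LatticeSpace m n) {k : ℕ} (I : Fin (k + 1) → LatticeSpace m n) :
    Prop :=
  I 0 = x ∧ ∀ i : Fin k, I i.succ ∈ asymptoticAcc (I i.castSucc)

/-- `x` is `k`-divergent: `k` is the supremum (in `ℕ ∪ {∞}`) of `length(I) - 1` over all
accumulation sequences `I` for `x`. -/
def IsKDivergent {m n : ℕ} (x : LatticeSpace m n) (k : ℕ∞) : Prop :=
  k = sSup {l : ℕ∞ | ∃ (j : ℕ) (I : Fin (j + 1) → LatticeSpace m n), IsAccSeq x I ∧ l = j}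

/-- A matrix `A` is `k`-divergent if the lattice `x_A` is. -/
def MatrixIsKDivergent {m n : ℕ} (A : Matrix (Fin m) (Fin n) ℝ) (k : ℕ∞) : Prop :=
  IsKDivergent (latticeOf A) k

end InhomApprox

end

/-!
Badly approximable targets correspond to grids: with `ξ ∈ ℝ^m`, the points `(p + A q - ξ, q)` of
the grid `x_A - (ξ, 0)` with large `q` satisfy `‖y‖^{n/m} ‖x‖ ≥ c` when `ξ` is badly approximable,
and `‖y‖^{n/m} ‖x‖` is invariant under the flow `h_t`. Hence it suffices to move a point of the
grid, at a late time, close to a point with `y ≠ 0` and small `‖y‖^{n/m} ‖x‖`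
(`notMem_farSet_of_mem_cusp`). As `ξ` varies over a short segment in direction `u`, the flow
stretches the segment, and the question is how much of `ℝ^d` the images of `[-r, r] u + x_A` fill
out at late times, for arbitrarily small `r`.

The notion `Approximable` records this: a set `S` is approximable at a lattice `g ℤ^d` if at
arbitrarily late times `h_t x_A` is close to `g ℤ^d` and `h_t ([-r, r] u + x_A)` is close to all
points of any finite part of `S`. At a first accumulation point of the orbit of `x_A` the line `ℝ
u` is approximable (`approximable_span_singleton`). The central fact is that each further step of
an accumulation sequence raises the dimension of an approximable subspace `V`
(`Approximable.exists_finrank_gt`). Limits of the subspaces `h_t V` are approximable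
(`Approximable.exists_limit`), and short vectors of `V + g ℤ^d` outside `V` generate a further
approximable line (`Approximable.exists_finrank_succ`). So if the dimension does not grow, then
`V` and its limit are spanned by lattice points (`exists_adapted_basis`), and in adapted bases the
convergence of the lattices becomes a convergence of matrices `h_t P D`, with `D` integral and
block triangular, to an invertible matrix. The minors of the columns spanning `V` are then those
of `P` up to sign, multiplied by `exp (w t)`, where `w = a d - j m` for some `a` and `j = dim V`.
Coprimality of `m` and `n` gives `w ≠ 0` for `0 < j < d`, so no minor can have a finite non-zero
limit (`not_tendsto_of_block_triangular`).

The hypothesis on `A` provides an accumulation sequence of length at least `d`, and hence an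
approximable hyperplane (`exists_approximable_hyperplane`). Any translate of a hyperplane together
with a lattice contains points with `y ≠ 0` and `‖y‖^{n/m} ‖x‖` as small as desired
(`exists_add_mem_cusp`). By compactness finitely many elements serve for all grids over lattices
near `g ℤ^d`, so boundedly many translations by numbers in `[-r, r]` move any point of a line in
direction `u` out of the set of badly approximable targets with given constants
(`exists_translates_notMem_farSet`). The bound does not depend on `r`, and the Lebesgue density
theorem shows that this set is null on each line (`ae_notMem_farSet`). For an algebraic measure,
only its invariance under the translations by `ℝ u` is needed, by Fubini
(`measure_eq_zero_of_invariant`).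
-/

noncomputable section

namespace InhomApprox

open Matrix

variable {m n : ℕ}

/-! ### Lattices and approximable sets -/

/-- The image of `SL_d(ℤ) → SL_d(ℝ)` as a map. -/
def intSL (δ : SpecialLinearGroup (Fin m ⊕ Fin n) ℤ) : G m n :=
  SpecialLinearGroup.map (Int.castRingHom ℝ) δ

/-- The linear action of `SL_d(ℝ)` on `ℝ^d`. -/
def act (g : G m n) : (Fin m ⊕ Fin n → ℝ) →ₗ[ℝ] (Fin m ⊕ Fin n → ℝ) :=
  Matrix.mulVecLin (Subtype.val g)

theorem act_apply (g : G m n) (x : Fin m ⊕ Fin n → ℝ) : act g x = Subtype.val g *ᵥ x := rfl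

theorem act_mul (g h : G m n) (x : Fin m ⊕ Fin n → ℝ) : act (g * h) x = act g (act h x) :=
  (Matrix.mulVec_mulVec x (Subtype.val g) (Subtype.val h)).symm

theorem act_one (x : Fin m ⊕ Fin n → ℝ) : act (1 : G m n) x = x :=
  Matrix.one_mulVec x

theorem injective_act (g : G m n) : Function.Injective (act g) := fun x y h => by
  have : act (g⁻¹ * g) x = act (g⁻¹ * g) y := by rw [act_mul, act_mul, h]
  simpa [act_one] using this

/-- The lattice `g ℤ^d` as a subgroup of `ℝ^d`. -/
def lattice (g : G m n) : AddSubgroup (Fin m ⊕ Fin n → ℝ) :=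
  ((act g).toAddMonoidHom.comp ((Int.castAddHom ℝ).compLeft (Fin m ⊕ Fin n))).range

theorem mem_lattice {g : G m n} {x : Fin m ⊕ Fin n → ℝ} :
    x ∈ lattice g ↔ ∃ z : Fin m ⊕ Fin n → ℤ, act g (fun i => (z i : ℝ)) = x :=
  Iff.rfl

theorem act_intSL (δ : SpecialLinearGroup (Fin m ⊕ Fin n) ℤ) (z : Fin m ⊕ Fin n → ℤ) :
    act (intSL δ) (fun i => (z i : ℝ)) = fun i => ((δ.1 *ᵥ z) i : ℝ) := by
  change δ.1.map (Int.castRingHom ℝ) *ᵥ (fun i => (z i : ℝ)) = _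
  ext i
  simp [Matrix.mulVec, dotProduct]

theorem lattice_mul_intSL_le (g : G m n) (δ : SpecialLinearGroup (Fin m ⊕ Fin n) ℤ) :
    lattice (g * intSL δ) ≤ lattice g := by
  intro x hx
  obtain ⟨z, rfl⟩ := mem_lattice.1 hx
  exact mem_lattice.2 ⟨δ.1 *ᵥ z, by rw [act_mul, act_intSL]⟩

theorem flow_val (t : ℝ) : Subtype.val (flow m n t) =
    Matrix.diagonal (Sum.elim (fun _ => Real.exp (n * t)) fun _ => Real.exp (-(m * t))) := by
  change Matrix.fromBlocks _ _ _ _ = _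
  rw [Matrix.smul_one_eq_diagonal, Matrix.smul_one_eq_diagonal, Matrix.fromBlocks_diagonal]

theorem act_flow_inl (t : ℝ) (x : Fin m ⊕ Fin n → ℝ) (i : Fin m) :
    act (flow m n t) x (Sum.inl i) = Real.exp (n * t) * x (Sum.inl i) := by
  rw [act_apply, flow_val, Matrix.mulVec_diagonal, Sum.elim_inl]

theorem act_flow_inr (t : ℝ) (x : Fin m ⊕ Fin n → ℝ) (i : Fin n) :
    act (flow m n t) x (Sum.inr i) = Real.exp (-(m * t)) * x (Sum.inr i) := by
  rw [act_apply, flow_val, Matrix.mulVec_diagonal, Sum.elim_inr]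

theorem act_injective : Function.Injective (act : G m n → _) := fun _ _ h =>
  Subtype.ext (Matrix.mulVec_injective (funext fun x => LinearMap.congr_fun h x))

theorem flow_add (s t : ℝ) : flow m n (s + t) = flow m n s * flow m n t := by
  apply act_injective
  ext x (i | i)
  all_goals
    simp only [LinearMap.comp_apply, act_mul, act_flow_inl, act_flow_inr, ← mul_assoc,
      ← Real.exp_add]
    ring_nf

theorem flow_zero : flow m n 0 = 1 := by
  apply act_injective
  ext x (i | i) <;> simp [act_one, act_flow_inl, act_flow_inr]

/-- `S` is approximable at the lattice `g ℤ^d` by the `u`-direction at `g₀ ℤ^d`: there are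
arbitrarily late times `t` at which `h_t g₀ ℤ^d` is close to `g ℤ^d` and at which arbitrarily short
segments of the lines in `ℝ u + g₀ ℤ^d` are moved by `h_t` close to all points of any prescribed
finite part of `S`. Closeness of lattices is expressed by closeness of representatives in
`SL_d(ℝ)`. -/
def Approximable (g₀ : G m n) (u : Fin m ⊕ Fin n → ℝ) (g : G m n)
    (S : Set (Fin m ⊕ Fin n → ℝ)) : Prop :=
  ∀ F : Set (Fin m ⊕ Fin n → ℝ), F.Finite → F ⊆ S → ∀ O ∈ 𝓝 g, ∀ r > 0, ∀ ε > 0, ∀ T : ℝ,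
    ∃ t ≥ T, (∃ γ, flow m n t * g₀ * intSL γ ∈ O) ∧
      ∀ s ∈ F, ∃ τ : ℝ, |τ| ≤ r ∧ ∃ v ∈ lattice g₀, ‖act (flow m n t) (τ • u + v) - s‖ ≤ ε

theorem continuous_act (x : Fin m ⊕ Fin n → ℝ) :
    Continuous fun g : G m n => act g x :=
  Continuous.matrix_mulVec continuous_subtype_val continuous_const

/-- Lattice points can be adjoined to an approximable subspace: they need no `u`-component. -/
theorem Approximable.sup_lattice {g₀ g : G m n} {u : Fin m ⊕ Fin n → ℝ}
    {V : Submodule ℝ (Fin m ⊕ Fin n → ℝ)} (h : Approximable g₀ u g V) :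
    Approximable g₀ u g (V.toAddSubgroup ⊔ lattice g : AddSubgroup (Fin m ⊕ Fin n → ℝ)) := by
  intro F hF hFS O hO r hr ε hε T
  have hdec : ∀ s : F, ∃ v ∈ V, ∃ z : Fin m ⊕ Fin n → ℤ,
      s.1 = v + act g (fun i => (z i : ℝ)) := by
    intro s
    obtain ⟨v, hv, y, hy, hvy⟩ := AddSubgroup.mem_sup.1 (hFS s.2)
    obtain ⟨z, hz⟩ := mem_lattice.1 hy
    exact ⟨v, hv, z, by rw [hz, hvy]⟩
  choose v hv z hz using hdec
  have : Finite F := hF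
  let O' : Set (G m n) := O ∩ ⋂ s : F,
    {g' | ‖act g' (fun i => (z s i : ℝ)) - act g (fun i => (z s i : ℝ))‖ < ε / 2}
  have hO' : O' ∈ 𝓝 g := by
    refine inter_mem hO (iInter_mem.2 fun s => ?_)
    have hc : Continuous fun g' : G m n =>
        ‖act g' (fun i => (z s i : ℝ)) - act g (fun i => (z s i : ℝ))‖ :=
      ((continuous_act _).sub continuous_const).norm
    exact (isOpen_lt hc continuous_const).mem_nhds (by simpa using half_pos hε)
  obtain ⟨t, htT, ⟨γ, hγ⟩, happ⟩ := h (Set.range v) (Set.finite_range v)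
    (by rintro _ ⟨s, rfl⟩; exact hv s) O' hO' r hr (ε / 2) (half_pos hε) T
  refine ⟨t, htT, ⟨γ, hγ.1⟩, fun s hs => ?_⟩
  obtain ⟨τ, hτ, y, hy, hd⟩ := happ (v ⟨s, hs⟩) ⟨_, rfl⟩
  have hclose := Set.mem_iInter.1 hγ.2 ⟨s, hs⟩
  rw [Set.mem_ofPred_eq] at hclose
  set ζ : Fin m ⊕ Fin n → ℝ := fun i => (z ⟨s, hs⟩ i : ℝ) with hζ
  have hmem : act g₀ (act (intSL γ) ζ) ∈ lattice g₀ := by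
    refine lattice_mul_intSL_le g₀ γ (mem_lattice.2 ⟨z ⟨s, hs⟩, ?_⟩)
    rw [act_mul]
  refine ⟨τ, hτ, y + act g₀ (act (intSL γ) ζ), add_mem hy hmem, ?_⟩
  have e : act (flow m n t) (τ • u + (y + act g₀ (act (intSL γ) ζ))) - s
      = (act (flow m n t) (τ • u + y) - v ⟨s, hs⟩)
        + (act (flow m n t * g₀ * intSL γ) ζ - act g ζ) := by
    have hs' : s = v ⟨s, hs⟩ + act g ζ := hz ⟨s, hs⟩
    rw [← add_assoc, map_add _ (τ • u + y), act_mul, act_mul, sub_eq_iff_eq_add]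
    refine Eq.trans ?_ (congrArg _ hs').symm
    abel
  rw [e]
  linarith [norm_add_le (act (flow m n t) (τ • u + y) - v ⟨s, hs⟩)
    (act (flow m n t * g₀ * intSL γ) ζ - act g ζ)]

theorem exists_norm_mulVec_le (h : G m n) : ∃ C > 0, ∀ x, ‖act h x‖ ≤ C * ‖x‖ := by
  have := (LinearMap.toContinuousLinearMap (act h)).isBoundedLinearMap.bound
  simpa using this

/-- Transport of approximability along the flow: what `h_t`, `t ≥ 0`, moves close to `S` from
an approximable set at `g ℤ^d` is approximable at every limit `g' ℤ^d` of `h_t g ℤ^d`. -/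
theorem Approximable.transport {g₀ g g' : G m n} {u : Fin m ⊕ Fin n → ℝ}
    {S S' : Set (Fin m ⊕ Fin n → ℝ)} (h : Approximable g₀ u g S) {κ : Type*} {l : Filter κ}
    [l.NeBot] {t : κ → ℝ} (ht : ∀ᶠ k in l, 0 ≤ t k)
    {δ : κ → SpecialLinearGroup (Fin m ⊕ Fin n) ℤ}
    (hlim : Tendsto (fun k => flow m n (t k) * g * intSL (δ k)) l (𝓝 g'))
    (hS : ∀ s ∈ S', ∃ σ : κ → (Fin m ⊕ Fin n → ℝ), (∀ᶠ k in l, σ k ∈ S) ∧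
      Tendsto (fun k => act (flow m n (t k)) (σ k)) l (𝓝 s)) :
    Approximable g₀ u g' S' := by
  intro F hF hFS O hO r hr ε hε T
  have hS' : ∀ s : F, ∃ σ : κ → (Fin m ⊕ Fin n → ℝ), (∀ᶠ k in l, σ k ∈ S) ∧
      Tendsto (fun k => act (flow m n (t k)) (σ k)) l (𝓝 s.1) := fun s => hS s.1 (hFS s.2)
  choose σ hσS hσ using hS'
  have : Finite F := hF
  have ev1 : ∀ᶠ k in l, ∀ s : F, σ s k ∈ S := eventually_all.2 hσS
  have ev2 : ∀ᶠ k in l, ∀ s : F, ‖act (flow m n (t k)) (σ s k) - s.1‖ < ε / 2 :=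
    eventually_all.2 fun s => by
      simpa [dist_eq_norm] using (Metric.tendsto_nhds.1 (hσ s)) (ε / 2) (half_pos hε)
  obtain ⟨k, hk0, hk1, hk2, hk3⟩ := (ht.and (ev1.and (ev2.and
    (hlim.eventually (eventually_mem_nhds_iff.2 hO))))).exists
  obtain ⟨C, hC, hCle⟩ := exists_norm_mulVec_le (flow m n (t k))
  have hO1 : {g1 : G m n | flow m n (t k) * g1 * intSL (δ k) ∈ O} ∈ 𝓝 g := by
    have hc : Continuous fun g1 : G m n => flow m n (t k) * g1 * intSL (δ k) := by fun_prop
    exact hc.continuousAt hk3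
  obtain ⟨t', ht', ⟨γ, hγ⟩, happ⟩ := h (Set.range fun s => σ s k) (Set.finite_range _)
    (by rintro _ ⟨s, rfl⟩; exact hk1 s) _ hO1 r hr (ε / 2 / C) (by positivity) T
  refine ⟨t k + t', by linarith, ⟨γ * δ k, ?_⟩, fun s hs => ?_⟩
  · have : flow m n (t k + t') * g₀ * intSL (γ * δ k)
        = flow m n (t k) * (flow m n t' * g₀ * intSL γ) * intSL (δ k) := by
      have e1 : (intSL (γ * δ k) : G m n) = intSL γ * intSL (δ k) :=
        map_mul (SpecialLinearGroup.map (Int.castRingHom ℝ)) γ (δ k)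
      rw [flow_add, e1]
      simp only [mul_assoc]
    rw [this]
    exact hγ
  · obtain ⟨τ, hτ, v, hv, hd⟩ := happ _ ⟨⟨s, hs⟩, rfl⟩
    refine ⟨τ, hτ, v, hv, ?_⟩
    have e : act (flow m n (t k + t')) (τ • u + v) - s
        = act (flow m n (t k)) (act (flow m n t') (τ • u + v) - σ ⟨s, hs⟩ k)
          + (act (flow m n (t k)) (σ ⟨s, hs⟩ k) - s) := by
      rw [flow_add, act_mul, map_sub]
      abel
    rw [e]
    have h1 := hCle (act (flow m n t') (τ • u + v) - σ ⟨s, hs⟩ k)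
    have h2 : C * ‖act (flow m n t') (τ • u + v) - σ ⟨s, hs⟩ k‖ ≤ ε / 2 := by
      calc _ ≤ C * (ε / 2 / C) := by gcongr
        _ = ε / 2 := by field_simp
    have h3 := (hk2 ⟨s, hs⟩).le
    refine (norm_add_le _ _).trans ?_
    linarith

/-! ### Limits of orthonormal frames -/

section Frames

variable {ι : Type*} [Fintype ι] {p : ℕ}

/-- Orthonormality of a finite family of vectors for the standard dot product. -/
def IsFrame (e : Fin p → ι → ℝ) : Prop :=
  ∀ i j, e i ⬝ᵥ e j = if i = j then 1 else 0

theorem exists_isFrame (W : Submodule ℝ (ι → ℝ)) (hW : Module.finrank ℝ W = p) :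
    ∃ e : Fin p → ι → ℝ, (∀ i, e i ∈ W) ∧ IsFrame e := by
  let L := (WithLp.linearEquiv 2 ℝ (ι → ℝ)).symm
  let W' : Submodule ℝ (EuclideanSpace ℝ ι) := W.map L.toLinearMap
  have hW' : Module.finrank ℝ W' = p := by rw [← hW]; exact LinearEquiv.finrank_map_eq L W
  let b := (stdOrthonormalBasis ℝ W').reindex (finCongr hW')
  refine ⟨fun i => (b i : EuclideanSpace ℝ ι).ofLp, fun i => ?_, fun i j => ?_⟩
  · obtain ⟨w, hw, hwb⟩ := (b i).2
    have : (b i : EuclideanSpace ℝ ι).ofLp = w := (congrArg WithLp.ofLp hwb).symm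
    simp only [this]
    exact hw
  · have h := orthonormal_iff_ite.1 b.orthonormal j i
    rw [Submodule.coe_inner, EuclideanSpace.inner_eq_star_dotProduct] at h
    simp only [star_trivial] at h
    rw [h]
    simp [eq_comm]

theorem exists_perp (W : Submodule ℝ (ι → ℝ)) (x : ι → ℝ) :
    ∃ w, x - w ∈ W ∧ ∀ v ∈ W, v ⬝ᵥ w = 0 := by
  let L := (WithLp.linearEquiv 2 ℝ (ι → ℝ)).symm
  let W' : Submodule ℝ (EuclideanSpace ℝ ι) := W.map L.toLinearMap
  obtain ⟨y, hy, z, hz, hyz⟩ := W'.exists_add_mem_mem_orthogonal (L x)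
  refine ⟨z.ofLp, ?_, fun v hv => ?_⟩
  · obtain ⟨w, hw, rfl⟩ := hy
    have : x - z.ofLp = w := by
      have := congrArg WithLp.ofLp hyz
      rw [sub_eq_iff_eq_add]
      exact this
    rw [this]; exact hw
  · have h := (Submodule.mem_orthogonal _ _).1 hz (L v) ⟨v, hv, rfl⟩
    rw [EuclideanSpace.inner_eq_star_dotProduct] at h
    rw [dotProduct_comm]
    exact h

theorem sq_le_dotProduct_self (x : ι → ℝ) (i : ι) : x i ^ 2 ≤ x ⬝ᵥ x := by
  rw [sq]
  exact Finset.single_le_sum (f := fun i => x i * x i) (fun j _ => mul_self_nonneg _)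
    (Finset.mem_univ i)

theorem norm_le_sqrt_dotProduct_self (x : ι → ℝ) : ‖x‖ ≤ √(x ⬝ᵥ x) :=
  (pi_norm_le_iff_of_nonneg (Real.sqrt_nonneg _)).2 fun i => by
    rw [Real.norm_eq_abs]
    exact Real.abs_le_sqrt (sq_le_dotProduct_self x i)

theorem isCompact_setOf_isFrame : IsCompact {e : Fin p → ι → ℝ | IsFrame e} := by
  refine Metric.isCompact_of_isClosed_isBounded ?_ ?_
  · have : {e : Fin p → ι → ℝ | IsFrame e} =
        ⋂ i, ⋂ j, {e | e i ⬝ᵥ e j = if i = j then 1 else 0} := by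
      ext e; simp [IsFrame]
    rw [this]
    refine isClosed_iInter fun i => isClosed_iInter fun j => isClosed_eq ?_ continuous_const
    simp only [dotProduct]
    fun_prop
  · refine (Metric.isBounded_closedBall (x := 0) (r := 1)).subset fun e he => ?_
    rw [mem_closedBall_zero_iff, pi_norm_le_iff_of_nonneg zero_le_one]
    intro i
    refine (norm_le_sqrt_dotProduct_self _).trans ?_
    rw [he i i]
    simp

theorem IsFrame.dotProduct_sum {e : Fin p → ι → ℝ} (he : IsFrame e) (a : Fin p → ℝ) (j : Fin p) :
    e j ⬝ᵥ ∑ i, a i • e i = a j := by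
  rw [_root_.dotProduct_sum]
  simp [he j]

theorem IsFrame.linearIndependent {e : Fin p → ι → ℝ} (he : IsFrame e) :
    LinearIndependent ℝ e := by
  rw [Fintype.linearIndependent_iff]
  intro a ha j
  rw [← he.dotProduct_sum a j, ha, dotProduct_zero]

theorem IsFrame.finrank_span {e : Fin p → ι → ℝ} (he : IsFrame e) :
    Module.finrank ℝ (Submodule.span ℝ (Set.range e)) = p := by
  rw [finrank_span_eq_card he.linearIndependent, Fintype.card_fin]

end Frames

/-- If linear combinations of the members of orthonormal frames `e k` become arbitrarily close to
`h_t`-images of points of `V + g ℤ^d`, then the frames converge along the ultrafilter and the span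
of the limit frame is approximable at `g' ℤ^d`. -/
theorem Approximable.exists_frame_limit {g₀ g g' : G m n} {u : Fin m ⊕ Fin n → ℝ}
    {V : Submodule ℝ (Fin m ⊕ Fin n → ℝ)} (h : Approximable g₀ u g V) {κ : Type*}
    {l : Ultrafilter κ} {t : κ → ℝ} (ht : ∀ᶠ k in l, 0 ≤ t k)
    {δ : κ → SpecialLinearGroup (Fin m ⊕ Fin n) ℤ}
    (hlim : Tendsto (fun k => flow m n (t k) * g * intSL (δ k)) l (𝓝 g')) {p : ℕ}
    {e : κ → Fin p → (Fin m ⊕ Fin n → ℝ)} (he : ∀ᶠ k in l, IsFrame (e k))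
    (happ : ∀ a : Fin p → ℝ, ∃ σ : κ → (Fin m ⊕ Fin n → ℝ),
      (∀ᶠ k in l, σ k ∈ V.toAddSubgroup ⊔ lattice g) ∧
      Tendsto (fun k => act (flow m n (t k)) (σ k) - ∑ i, a i • e k i) l (𝓝 0)) :
    ∃ e' : Fin p → (Fin m ⊕ Fin n → ℝ), IsFrame e' ∧ Tendsto e l (𝓝 e') ∧
      Approximable g₀ u g' (Submodule.span ℝ (Set.range e')) := by
  obtain ⟨e', he', hle⟩ := isCompact_setOf_isFrame.ultrafilter_le_nhds (l.map e)
    (le_principal_iff.2 he)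
  refine ⟨e', he', hle, h.sup_lattice.transport ht hlim fun s hs => ?_⟩
  obtain ⟨a, rfl⟩ := (Submodule.mem_span_range_iff_exists_fun ℝ).1 hs
  obtain ⟨σ, hσ, hσlim⟩ := happ a
  refine ⟨σ, hσ, ?_⟩
  have h2 : Tendsto (fun k => ∑ i, a i • e k i) l (𝓝 (∑ i, a i • e' i)) :=
    tendsto_finsetSum _ fun i _ =>
      ((continuous_apply i).tendsto e' |>.comp hle).const_smul (a i)
  simpa using hσlim.add h2

/-- The image of an approximable subspace under the flow subconverges to an approximable
subspace of the same dimension. -/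
theorem Approximable.exists_limit {g₀ g g' : G m n} {u : Fin m ⊕ Fin n → ℝ}
    {V : Submodule ℝ (Fin m ⊕ Fin n → ℝ)} (h : Approximable g₀ u g V) {κ : Type*}
    {l : Ultrafilter κ} {t : κ → ℝ} (ht : ∀ᶠ k in l, 0 ≤ t k)
    {δ : κ → SpecialLinearGroup (Fin m ⊕ Fin n) ℤ}
    (hlim : Tendsto (fun k => flow m n (t k) * g * intSL (δ k)) l (𝓝 g')) :
    ∃ V' : Submodule ℝ (Fin m ⊕ Fin n → ℝ), Approximable g₀ u g' V' ∧
      Module.finrank ℝ V' = Module.finrank ℝ V ∧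
      ∀ s ∈ V', ∃ σ : κ → (Fin m ⊕ Fin n → ℝ), (∀ k, σ k ∈ V) ∧
        Tendsto (fun k => act (flow m n (t k)) (σ k)) l (𝓝 s) := by
  have hfr : ∀ k, ∃ e : Fin (Module.finrank ℝ V) → (Fin m ⊕ Fin n → ℝ),
      (∀ i, e i ∈ V.map (act (flow m n (t k)))) ∧ IsFrame e := fun k =>
    exists_isFrame _ ((Submodule.equivMapOfInjective _ (injective_act _) V).finrank_eq.symm)
  choose e heV he using hfr
  have hpre : ∀ a : Fin (Module.finrank ℝ V) → ℝ, ∀ k, ∃ v ∈ V,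
      act (flow m n (t k)) v = ∑ i, a i • e k i := fun a k =>
    Submodule.mem_map.1 (Submodule.sum_mem _ fun i _ => Submodule.smul_mem _ _ (heV k i))
  choose σ hσV hσ using hpre
  obtain ⟨e', he', hlim', happ⟩ := h.exists_frame_limit ht hlim (.of_forall he) fun a =>
    ⟨σ a, .of_forall fun k => AddSubgroup.mem_sup_left (hσV a k), by simp [hσ]⟩
  refine ⟨_, happ, he'.finrank_span, fun s hs => ?_⟩
  obtain ⟨a, rfl⟩ := (Submodule.mem_span_range_iff_exists_fun ℝ).1 hs
  refine ⟨σ a, hσV a, ?_⟩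
  simp only [hσ]
  exact tendsto_finsetSum _ fun i _ =>
      ((continuous_apply i).tendsto e' |>.comp hlim').const_smul (a i)

/-- Points `c k` of `V + g ℤ^d` outside `V` which `h_t` moves towards `0` produce a new
approximable direction: the integer multiples of the component of `h_t c k` orthogonal to `h_t V`
fill out a line in the limit. -/
theorem Approximable.exists_finrank_succ {g₀ g g' : G m n} {u : Fin m ⊕ Fin n → ℝ}
    {V : Submodule ℝ (Fin m ⊕ Fin n → ℝ)} (h : Approximable g₀ u g V) {κ : Type*}
    {l : Ultrafilter κ} {t : κ → ℝ} (ht : ∀ᶠ k in l, 0 ≤ t k)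
    {δ : κ → SpecialLinearGroup (Fin m ⊕ Fin n) ℤ}
    (hlim : Tendsto (fun k => flow m n (t k) * g * intSL (δ k)) l (𝓝 g'))
    {c : κ → (Fin m ⊕ Fin n → ℝ)} (hc : ∀ᶠ k in l, c k ∈ V.toAddSubgroup ⊔ lattice g)
    (hcV : ∀ᶠ k in l, c k ∉ V)
    (hc0 : Tendsto (fun k => act (flow m n (t k)) (c k)) l (𝓝 0)) :
    ∃ V' : Submodule ℝ (Fin m ⊕ Fin n → ℝ), Approximable g₀ u g' V' ∧
      Module.finrank ℝ V' = Module.finrank ℝ V + 1 := by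
  have hfr : ∀ k, ∃ e : Fin (Module.finrank ℝ V) → (Fin m ⊕ Fin n → ℝ),
      (∀ i, e i ∈ V.map (act (flow m n (t k)))) ∧ IsFrame e := fun k =>
    exists_isFrame _ ((Submodule.equivMapOfInjective _ (injective_act _) V).finrank_eq.symm)
  choose f hfV hf using hfr
  choose w hw hperp using fun k =>
    exists_perp (V.map (act (flow m n (t k)))) (act (flow m n (t k)) (c k))
  choose v hvV hv using fun k => Submodule.mem_map.1 (hw k)
  have hwv : ∀ k, w k = act (flow m n (t k)) (c k - v k) := fun k => by
    rw [map_sub, hv]; abel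
  have hpos : ∀ᶠ k in l, 0 < w k ⬝ᵥ w k := by
    filter_upwards [hcV] with k hk
    have hne : w k ≠ 0 := by
      intro h0
      rw [hwv] at h0
      have := injective_act (flow m n (t k)) (h0.trans (map_zero _).symm)
      exact hk (sub_eq_zero.1 this ▸ hvV k)
    exact (dotProduct_self_star_pos_iff (v := w k)).2 hne
  -- the orthogonal component is no longer than the vector itself
  have hle : ∀ k, w k ⬝ᵥ w k ≤ act (flow m n (t k)) (c k) ⬝ᵥ act (flow m n (t k)) (c k) := by
    intro k
    have h1 := hperp k _ (hw k)
    have h2 : act (flow m n (t k)) (c k) = (act (flow m n (t k)) (c k) - w k) + w k := by abel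
    set b := act (flow m n (t k)) (c k) - w k
    have h3 : w k ⬝ᵥ b = 0 := by rw [dotProduct_comm]; exact h1
    have h4 : 0 ≤ b ⬝ᵥ b := Finset.sum_nonneg fun i _ => mul_self_nonneg _
    rw [h2, add_dotProduct, dotProduct_add, dotProduct_add, h1, h3]
    linarith
  have hw0 : Tendsto (fun k => √(w k ⬝ᵥ w k)) l (𝓝 0) := by
    have hd : Tendsto (fun k => √(act (flow m n (t k)) (c k) ⬝ᵥ act (flow m n (t k)) (c k))) l
        (𝓝 0) := by
      have hcont : Continuous fun x : Fin m ⊕ Fin n → ℝ => √(x ⬝ᵥ x) := by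
        simp only [dotProduct]; fun_prop
      simpa using! (hcont.tendsto 0).comp hc0
    exact squeeze_zero (fun k => Real.sqrt_nonneg _) (fun k => Real.sqrt_le_sqrt (hle k)) hd
  let ω : κ → (Fin m ⊕ Fin n → ℝ) := fun k => (√(w k ⬝ᵥ w k))⁻¹ • w k
  let e : κ → Fin (Module.finrank ℝ V + 1) → (Fin m ⊕ Fin n → ℝ) := fun k =>
    Fin.snoc (f k) (ω k)
  have he : ∀ᶠ k in l, IsFrame (e k) := by
    filter_upwards [hpos] with k hk
    have hfω : ∀ i, f k i ⬝ᵥ ω k = 0 := fun i => by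
      simp [ω, hperp k _ (hfV k i)]
    have hωω : ω k ⬝ᵥ ω k = 1 := by
      simp only [ω, smul_dotProduct, dotProduct_smul, smul_eq_mul, ← mul_assoc]
      rw [← mul_inv, Real.mul_self_sqrt hk.le, inv_mul_cancel₀ hk.ne']
    intro i j
    refine Fin.lastCases ?_ (fun i => ?_) i <;> refine Fin.lastCases ?_ (fun j => ?_) j
    · simp [e, hωω]
    · have := hfω j
      rw [dotProduct_comm] at this
      simp [e, this, (Fin.castSucc_lt_last j).ne']
    · simp [e, hfω i, (Fin.castSucc_lt_last i).ne]
    · simp [e, hf k i j]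
  have hpre : ∀ a : Fin (Module.finrank ℝ V + 1) → ℝ, ∀ k, ∃ v ∈ V,
      act (flow m n (t k)) v = ∑ i : Fin (Module.finrank ℝ V), a i.castSucc • f k i := fun a k =>
    Submodule.mem_map.1 (Submodule.sum_mem _ fun i _ => Submodule.smul_mem _ _ (hfV k i))
  choose σ hσV hσ using hpre
  obtain ⟨e', he', -, happ⟩ := h.exists_frame_limit ht hlim he fun a => by
    -- `N k` is the integer multiple of `w k` closest to the prescribed multiple of `ω k`
    let N : κ → ℤ := fun k => round (a (Fin.last _) * (√(w k ⬝ᵥ w k))⁻¹)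
    refine ⟨fun k => σ a k + N k • (c k - v k), ?_, ?_⟩
    · filter_upwards [hc] with k hk
      exact add_mem (AddSubgroup.mem_sup_left (hσV a k))
        (zsmul_mem (sub_mem hk (AddSubgroup.mem_sup_left (hvV k))) _)
    · have hbd : ∀ᶠ k in l, ‖act (flow m n (t k)) (σ a k + N k • (c k - v k))
          - ∑ i, a i • e k i‖ ≤ √(w k ⬝ᵥ w k) := by
        filter_upwards [hpos] with k hk
        have hs : 0 < √(w k ⬝ᵥ w k) := Real.sqrt_pos.2 hk
        have e1 : act (flow m n (t k)) (σ a k + N k • (c k - v k)) - ∑ i, a i • e k i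
            = ((N k : ℝ) - a (Fin.last _) * (√(w k ⬝ᵥ w k))⁻¹) • w k := by
          rw [map_add, map_zsmul, ← hwv, hσ, Fin.sum_univ_castSucc, sub_smul, mul_smul]
          simp only [e, Fin.snoc_castSucc, Fin.snoc_last, ω, Int.cast_smul_eq_zsmul]
          abel
        rw [e1, norm_smul, Real.norm_eq_abs, abs_sub_comm]
        have h1 := abs_sub_round (a (Fin.last _) * (√(w k ⬝ᵥ w k))⁻¹)
        have h2 := norm_le_sqrt_dotProduct_self (w k)
        nlinarith [norm_nonneg (w k), abs_nonneg (a (Fin.last _) * (√(w k ⬝ᵥ w k))⁻¹ - N k)]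
      exact squeeze_zero_norm' hbd hw0
  exact ⟨_, happ, he'.finrank_span⟩

/-- If no subspace of larger dimension is approximable at `g ℤ^d`, then the image of `g ℤ^d` modulo
an approximable subspace is discrete. -/
theorem Approximable.exists_discrete {g₀ g : G m n} {u : Fin m ⊕ Fin n → ℝ}
    {V : Submodule ℝ (Fin m ⊕ Fin n → ℝ)} (h : Approximable g₀ u g V)
    (hmax : ∀ V' : Submodule ℝ (Fin m ⊕ Fin n → ℝ), Approximable g₀ u g V' →
      Module.finrank ℝ V' ≤ Module.finrank ℝ V) :
    ∃ ε > 0, ∀ c ∈ V.toAddSubgroup ⊔ lattice g, ‖c‖ < ε → c ∈ V := by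
  by_contra! hcon
  choose c hc hcn hcV using fun k : ℕ => hcon (1 / ((k : ℝ) + 1)) (by positivity)
  have hl : Tendsto c (hyperfilter ℕ) (𝓝 0) :=
    (squeeze_zero_norm (fun k => (hcn k).le) tendsto_one_div_add_atTop_nhds_zero_nat).mono_left
      Nat.hyperfilter_le_atTop
  obtain ⟨V', hV', hdim⟩ := h.exists_finrank_succ (l := hyperfilter ℕ) (t := fun _ => 0)
    (δ := fun _ => 1) (g' := g) (by simp)
    (by simp [flow_zero, intSL]) (c := c) (.of_forall hc) (.of_forall hcV)
    (by simpa [flow_zero, act_one] using hl)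
  have := hmax V' hV'
  omega

/-! ### Bases of a lattice adapted to a subspace -/

/-- The parametrisation `z ↦ g z` of the lattice `g ℤ^d`, as a `ℤ`-linear map. -/
def latticeMap (g : G m n) : (Fin m ⊕ Fin n → ℤ) →ₗ[ℤ] (Fin m ⊕ Fin n → ℝ) :=
  ((act g).toAddMonoidHom.comp
    ((Int.castAddHom ℝ).compLeft (Fin m ⊕ Fin n))).toIntLinearMap

theorem latticeMap_apply (g : G m n) (z : Fin m ⊕ Fin n → ℤ) :
    latticeMap g z = act g (fun i => (z i : ℝ)) := rfl

theorem span_range_latticeMap (g : G m n) :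
    Submodule.span ℝ (Set.range (latticeMap g)) = ⊤ := by
  rw [eq_top_iff]
  intro x _
  have hx : x = act g (∑ i, (act g⁻¹ x) i • Pi.single i (1 : ℝ)) := by
    have : ∑ i, (act g⁻¹ x) i • Pi.single i (1 : ℝ) = act g⁻¹ x := by
      ext j; simp [Finset.sum_apply, Pi.single_apply]
    rw [this, ← act_mul, mul_inv_cancel, act_one]
  rw [hx, map_sum]
  refine Submodule.sum_mem _ fun i _ => ?_
  rw [map_smul]
  refine Submodule.smul_mem _ _ (Submodule.subset_span ⟨Pi.single i 1, ?_⟩)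
  rw [latticeMap_apply]
  congr 1
  ext j
  by_cases h : j = i
  · subst h; simp
  · simp [h]

/-- If `g ℤ^d` has discrete image modulo `V`, then `V` is spanned by its lattice points. -/
theorem finrank_comap_latticeMap (g : G m n) (V : Submodule ℝ (Fin m ⊕ Fin n → ℝ))
    (hd : ∃ ε > 0, ∀ c ∈ V.toAddSubgroup ⊔ lattice g, ‖c‖ < ε → c ∈ V) :
    Module.finrank ℤ ((V.restrictScalars ℤ).comap (latticeMap g)) = Module.finrank ℝ V := by
  have hclosed : IsClosed (V : Set (Fin m ⊕ Fin n → ℝ)) := V.closed_of_finiteDimensional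
  let ψ : (Fin m ⊕ Fin n → ℤ) →ₗ[ℤ] ((Fin m ⊕ Fin n → ℝ) ⧸ V) :=
    (V.mkQ.restrictScalars ℤ) ∘ₗ latticeMap g
  have hker : LinearMap.ker ψ = (V.restrictScalars ℤ).comap (latticeMap g) := by
    ext z
    simp [ψ]
  have hspan : Submodule.span ℝ (LinearMap.range ψ : Set ((Fin m ⊕ Fin n → ℝ) ⧸ V)) = ⊤ := by
    have : (LinearMap.range ψ : Set ((Fin m ⊕ Fin n → ℝ) ⧸ V))
        = V.mkQ '' Set.range (latticeMap g) := by
      rw [← Set.range_comp]; rfl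
    rw [this, ← Submodule.map_span, span_range_latticeMap, Submodule.map_top,
      Submodule.range_mkQ]
  have hspanZ : Submodule.span ℤ (LinearMap.range ψ : Set ((Fin m ⊕ Fin n → ℝ) ⧸ V))
      = LinearMap.range ψ := Submodule.span_eq _
  have hdisc : DiscreteTopology (Submodule.span ℤ
      (LinearMap.range ψ : Set ((Fin m ⊕ Fin n → ℝ) ⧸ V))) := by
    rw [hspanZ]
    obtain ⟨ε, hε, hd⟩ := hd
    refine discreteTopology_of_isOpen_singleton_zero ?_
    rw [Metric.isOpen_singleton_iff]
    refine ⟨ε, hε, fun y hy => ?_⟩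
    obtain ⟨_, z, rfl⟩ := y
    rw [dist_zero_right] at hy
    have hy' : ‖(Submodule.Quotient.mk (latticeMap g z) : (Fin m ⊕ Fin n → ℝ) ⧸ V)‖ < ε := hy
    -- lift a short vector of the quotient to a short vector of `V + g ℤ^d`
    obtain ⟨c, hc, hcε⟩ := Submodule.Quotient.norm_mk_lt (S := V) _ (sub_pos.2 hy')
    rw [add_sub_cancel] at hcε
    have hcV : c - latticeMap g z ∈ V := (Submodule.Quotient.eq V).1 hc
    have hcmem : c ∈ V.toAddSubgroup ⊔ lattice g := by
      rw [← sub_add_cancel c (latticeMap g z)]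
      exact AddSubgroup.add_mem_sup hcV (mem_lattice.2 ⟨z, rfl⟩)
    have := hd c hcmem hcε
    apply Subtype.ext
    change (Submodule.Quotient.mk (latticeMap g z) : (Fin m ⊕ Fin n → ℝ) ⧸ V) = 0
    rw [← hc]
    exact (Submodule.Quotient.mk_eq_zero V).2 this
  have h1 := Real.finrank_eq_int_finrank_of_discrete hdisc
  rw [Set.finrank, Set.finrank, hspan, hspanZ, finrank_top] at h1
  have h2 := (LinearMap.ker ψ).finrank_quotient_add_finrank
  rw [ψ.quotKerEquivRange.finrank_eq] at h2
  have h3 := V.finrank_quotient_add_finrank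
  rw [hker] at h2
  simp only [Module.finrank_fintype_fun_eq_card] at h2 h3
  omega

/-- A subspace spanned by points of `g ℤ^d` is spanned by part of a basis of `g ℤ^d`, and the
position of this part in the basis can be prescribed. -/
theorem exists_adapted_basis (g : G m n) (V : Submodule ℝ (Fin m ⊕ Fin n → ℝ))
    (hd : ∃ ε > 0, ∀ c ∈ V.toAddSubgroup ⊔ lattice g, ‖c‖ < ε → c ∈ V)
    (T : Finset (Fin m ⊕ Fin n)) (hT : T.card = Module.finrank ℝ V) :
    ∃ α : Matrix (Fin m ⊕ Fin n) (Fin m ⊕ Fin n) ℤ, IsUnit α.det ∧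
      ∀ i ∈ T, act g (fun a => (α a i : ℝ)) ∈ V := by
  set K := (V.restrictScalars ℤ).comap (latticeMap g) with hK
  obtain ⟨r, snf⟩ := K.smithNormalForm (Pi.basisFun ℤ (Fin m ⊕ Fin n))
  have hr : r = T.card := by
    rw [hT, ← finrank_comap_latticeMap g V hd, Module.finrank_eq_card_basis snf.bN,
      Fintype.card_fin]
  have hfK : ∀ i, snf.bM (snf.f i) ∈ K := by
    intro i
    -- `V` is closed under division by the elementary divisors
    have h0 : snf.a i ≠ 0 := by
      intro h0
      have := snf.snf i
      rw [h0, zero_smul] at this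
      exact snf.bN.ne_zero i (Subtype.ext this)
    have h1 : latticeMap g (snf.bN i : Fin m ⊕ Fin n → ℤ) ∈ V := (snf.bN i).2
    rw [snf.snf, map_zsmul, ← Int.cast_smul_eq_zsmul ℝ] at h1
    exact (V.smul_mem_iff (Int.cast_ne_zero.2 h0)).1 h1
  have hcard : T.card = (Finset.univ.map snf.f).card := by simp [hr]
  let σ := (Finset.equivOfCardEq hcard).extendSubtype
  have hσ : ∀ i ∈ T, ∃ j, snf.f j = σ i := fun i hi => by
    have := (Finset.equivOfCardEq hcard).extendSubtype_mem i hi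
    simpa using this
  let b := snf.bM.reindex σ.symm
  refine ⟨(Pi.basisFun ℤ (Fin m ⊕ Fin n)).toMatrix b,
    (Pi.basisFun ℤ (Fin m ⊕ Fin n)).isUnit_det b, fun i hi => ?_⟩
  obtain ⟨j, hj⟩ := hσ i hi
  have := hfK j
  rw [hj] at this
  simpa [Module.Basis.toMatrix_apply, b] using! this

/-! ### Minors and the weights of the flow -/

theorem exists_submatrix_det_ne_zero {ι : Type*} [Fintype ι] [DecidableEq ι] (B : Matrix ι ι ℝ)
    (hB : B.det ≠ 0) (T : Finset ι) :
    ∃ e : T → ι, (B.submatrix e (Subtype.val : T → ι)).det ≠ 0 := by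
  set M : Matrix ι T ℝ := B.submatrix id Subtype.val with hM
  have hcols : LinearIndependent ℝ M.col :=
    (Matrix.linearIndependent_cols_of_det_ne_zero hB).comp _ Subtype.val_injective
  have hrank : M.rank = T.card := by
    rw [← M.rank_transpose, LinearIndependent.rank_matrix (M := Mᵀ) hcols, Fintype.card_coe]
  rw [Matrix.rank_eq_finrank_span_row] at hrank
  obtain ⟨f, hf, -, hli⟩ := Submodule.exists_fun_fin_finrank_span_eq ℝ (Set.range M.row)
  choose e he using hf
  let E : T ≃ Fin (Module.finrank ℝ (Submodule.span ℝ (Set.range M.row))) :=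
    T.equivFin.trans (finCongr hrank.symm)
  refine ⟨e ∘ E, ?_⟩
  have hrow : LinearIndependent ℝ (B.submatrix (e ∘ E) (Subtype.val : T → ι)).row := by
    have : (B.submatrix (e ∘ E) (Subtype.val : T → ι)).row = f ∘ E := by
      funext i
      rw [Function.comp_apply, ← he]
      rfl
    rw [this]
    exact hli.comp _ E.injective
  exact (Matrix.isUnit_iff_isUnit_det _).1 (Matrix.linearIndependent_rows_iff_isUnit.1 hrow)
    |>.ne_zero

/-- The exponential rate at which the flow expands a coordinate; negative rates mean
contraction. -/
def weight (m n : ℕ) : Fin m ⊕ Fin n → ℤ := Sum.elim (fun _ => n) fun _ => -m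

theorem flow_val_eq (t : ℝ) : Subtype.val (flow m n t) =
    Matrix.diagonal fun i => Real.exp (weight m n i * t) := by
  rw [flow_val]
  congr 1
  ext (i | i) <;> simp [weight]

/-- By coprimality, the flow has no zero weight on `Λ^j ℝ^d` for `0 < j < d`. -/
theorem sum_weight_ne_zero (hmn : Nat.gcd m n = 1) {τ : Type*} [Fintype τ]
    (h0 : 0 < Fintype.card τ) (h1 : Fintype.card τ < m + n) (e : τ → Fin m ⊕ Fin n) :
    ∑ i, weight m n (e i) ≠ 0 := by
  intro h
  have hw : ∀ x : Fin m ⊕ Fin n,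
      weight m n x = (if x.isLeft then ((m + n : ℕ) : ℤ) else 0) - m := by
    rintro (x | x) <;> simp [weight]
  simp only [hw, Finset.sum_sub_distrib, Finset.sum_const, Finset.card_univ, ← Finset.sum_filter,
    nsmul_eq_mul, sub_eq_zero] at h
  have h2 : (m + n) ∣ Fintype.card τ * m := by
    refine ⟨(Finset.univ.filter fun i => (e i).isLeft = true).card, ?_⟩
    rw [mul_comm (m + n)]
    exact_mod_cast h.symm
  have hcop : Nat.Coprime (m + n) m := by
    rw [Nat.coprime_self_add_left]
    exact (Nat.coprime_comm).1 hmn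
  exact absurd (Nat.le_of_dvd h0 (hcop.dvd_of_dvd_mul_right h2)) (by omega)

/-- Matrices `h_t P D` with `t → ∞`, `D` integral unimodular and block triangular with respect to
a proper part `T` of the columns, do not converge to an invertible matrix: their minors on the
columns `T` are those of `P` scaled by `exp (w t)` with `w ≠ 0`. -/
theorem not_tendsto_of_block_triangular (hmn : Nat.gcd m n = 1) {κ : Type*} {l : Filter κ}
    [l.NeBot] {t : κ → ℝ} (ht : Tendsto t l atTop)
    (P B : Matrix (Fin m ⊕ Fin n) (Fin m ⊕ Fin n) ℝ) (hB : B.det ≠ 0)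
    (D : κ → Matrix (Fin m ⊕ Fin n) (Fin m ⊕ Fin n) ℤ) (T : Finset (Fin m ⊕ Fin n))
    (hT0 : 0 < T.card) (hT1 : T.card < m + n) (hD : ∀ᶠ k in l, IsUnit (D k).det)
    (hDT : ∀ᶠ k in l, ∀ i ∈ T, ∀ a ∉ T, D k a i = 0) :
    ¬ Tendsto (fun k => Subtype.val (flow m n (t k)) * P * (D k).map (Int.castRingHom ℝ)) l
      (𝓝 B) := by
  intro hlim
  obtain ⟨e, he⟩ := exists_submatrix_det_ne_zero B hB T
  set w : ℤ := ∑ i, weight m n (e i) with hw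
  have hw0 : w ≠ 0 := sum_weight_ne_zero hmn (by simpa using hT0) (by simpa using hT1) e
  set c : ℝ := (P.submatrix e (Subtype.val : T → _)).det with hc
  have hminor : ∀ᶠ k in l, |((Subtype.val (flow m n (t k)) * P *
      (D k).map (Int.castRingHom ℝ)).submatrix e (Subtype.val : T → _)).det|
      = Real.exp (w * t k) * |c| := by
    filter_upwards [hD, hDT] with k hk hkT
    have hfac : (Subtype.val (flow m n (t k)) * P *
        (D k).map (Int.castRingHom ℝ)).submatrix e (Subtype.val : T → _)
        = Matrix.diagonal (fun i => Real.exp (weight m n (e i) * t k)) *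
          P.submatrix e (Subtype.val : T → _) *
          ((D k).toSquareBlockProp (· ∈ T)).map (Int.castRingHom ℝ) := by
      ext i j
      rw [flow_val_eq, Matrix.submatrix_apply, Matrix.mul_apply, Matrix.mul_apply]
      have hz : ∀ a ∉ T, (Matrix.diagonal (fun i => Real.exp (weight m n i * t k)) * P) (e i) a *
          (D k).map (Int.castRingHom ℝ) a j = 0 := fun a ha => by
        simp [hkT j j.2 a ha]
      rw [← Finset.sum_subset (Finset.subset_univ T) fun a _ ha => hz a ha,
        ← Finset.sum_coe_sort]
      simp [Matrix.diagonal_mul, Matrix.toSquareBlockProp]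
    -- an integral block triangular matrix with unit determinant has blocks of unit determinant
    have hunit : |(((D k).toSquareBlockProp (· ∈ T)).det : ℝ)| = 1 := by
      have := Matrix.twoBlockTriangular_det (D k) (· ∈ T) fun i hi j hj => hkT j hj i hi
      rw [this] at hk
      have h1 : |((D k).toSquareBlockProp (· ∈ T)).det| = 1 := by
        convert! Int.isUnit_iff_abs_eq.1 (isUnit_of_mul_isUnit_left hk)
      exact_mod_cast h1
    have hdet : (((D k).toSquareBlockProp (· ∈ T)).map (Int.castRingHom ℝ)).det
        = (((D k).toSquareBlockProp (· ∈ T)).det : ℝ) :=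
      ((Int.castRingHom ℝ).map_det _).symm
    rw [hfac, Matrix.det_mul, Matrix.det_mul, Matrix.det_diagonal, hdet, abs_mul, hunit, mul_one,
      abs_mul, ← Real.exp_sum, Real.abs_exp, hw, Int.cast_sum, Finset.sum_mul]
  have hlim' : Tendsto (fun k => Real.exp (w * t k) * |c|) l
      (𝓝 |(B.submatrix e (Subtype.val : T → _)).det|) := by
    refine Tendsto.congr' hminor ?_
    have hcont : Continuous fun M : Matrix (Fin m ⊕ Fin n) (Fin m ⊕ Fin n) ℝ =>
        |(M.submatrix e (Subtype.val : T → _)).det| :=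
      ((continuous_id.matrix_submatrix _ _).matrix_det).abs
    exact (hcont.tendsto B).comp hlim
  have hpos := abs_pos.2 he
  rcases lt_or_gt_of_ne hw0 with hneg | hpos'
  · have h1 : Tendsto (fun k => Real.exp (w * t k)) l (𝓝 0) :=
      Real.tendsto_exp_atBot.comp (ht.const_mul_atTop_of_neg (Int.cast_lt_zero.2 hneg))
    have h2 := h1.mul_const |c|
    rw [zero_mul] at h2
    exact hpos.ne' (tendsto_nhds_unique hlim' h2)
  · have h1 : Tendsto (fun k => Real.exp (-(w * t k))) l (𝓝 0) :=
      Real.tendsto_exp_neg_atTop_nhds_zero.comp (ht.const_mul_atTop (Int.cast_pos.2 hpos'))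
    have h2 := h1.mul hlim'
    rw [zero_mul] at h2
    have h3 : (fun k => Real.exp (-(w * t k)) * (Real.exp (w * t k) * |c|)) = fun _ => |c| := by
      funext k
      rw [← mul_assoc, ← Real.exp_add]
      simp
    rw [h3] at h2
    have hc0 : |c| = 0 := tendsto_nhds_unique tendsto_const_nhds h2
    simp only [hc0, mul_zero] at hlim'
    exact hpos.ne' (tendsto_nhds_unique hlim' tendsto_const_nhds)

/-! ### Growth of the approximable subspace along accumulation sequences -/

theorem basis_repr_eq_zero_of_mem {ι E : Type*} [AddCommGroup E] [Module ℝ E]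
    [FiniteDimensional ℝ E] (b : Module.Basis ι ℝ E) (V : Submodule ℝ E) (T : Finset ι)
    (hT : T.card = Module.finrank ℝ V) (hb : ∀ i ∈ T, b i ∈ V) {x : E} (hx : x ∈ V) {a : ι}
    (ha : a ∉ T) : b.repr x a = 0 := by
  have hle : Submodule.span ℝ (b '' T) ≤ V :=
    Submodule.span_le.2 (by rintro _ ⟨i, hi, rfl⟩; exact hb i hi)
  have hcard : Module.finrank ℝ (Submodule.span ℝ (b '' T)) = T.card := by
    have hli := b.linearIndependent.comp (Subtype.val : T → ι) Subtype.val_injective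
    have := finrank_span_eq_card hli
    rw [Fintype.card_coe, Set.range_comp, Subtype.range_coe_subtype] at this
    exact this
  have heq := Submodule.eq_of_le_of_finrank_eq hle (hcard.trans hT)
  rw [← heq, b.mem_span_image] at hx
  by_contra h
  exact ha (hx (Finsupp.mem_support_iff.2 h))

/-- Passing from a lattice to an accumulation point of its forward orbit increases the dimension
of an approximable proper non-zero subspace. Otherwise the subspaces at both lattices are spanned
by lattice points, and in adapted bases the lattices `h_t g ℤ^d → g' ℤ^d` would contradict
`not_tendsto_of_block_triangular`. -/
theorem Approximable.exists_finrank_gt (hmn : Nat.gcd m n = 1) {g₀ g g' : G m n}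
    {u : Fin m ⊕ Fin n → ℝ} {κ : Type*} {l : Ultrafilter κ} {t : κ → ℝ}
    (ht : Tendsto t l atTop) {δ : κ → SpecialLinearGroup (Fin m ⊕ Fin n) ℤ}
    (hlim : Tendsto (fun k => flow m n (t k) * g * intSL (δ k)) l (𝓝 g')) {j : ℕ} (hj0 : 0 < j)
    (hj1 : j < m + n) (hV : ∃ V : Submodule ℝ (Fin m ⊕ Fin n → ℝ),
      Approximable g₀ u g V ∧ j ≤ Module.finrank ℝ V) :
    ∃ V' : Submodule ℝ (Fin m ⊕ Fin n → ℝ),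
      Approximable g₀ u g' V' ∧ j + 1 ≤ Module.finrank ℝ V' := by
  have ht0 : ∀ᶠ k in l, 0 ≤ t k := ht.eventually_ge_atTop 0
  by_cases hbig : ∃ V : Submodule ℝ (Fin m ⊕ Fin n → ℝ),
      Approximable g₀ u g V ∧ j + 1 ≤ Module.finrank ℝ V
  · obtain ⟨V, hV, hVj⟩ := hbig
    obtain ⟨V', hV', hdim, -⟩ := hV.exists_limit ht0 hlim
    exact ⟨V', hV', hdim ▸ hVj⟩
  by_contra hcon
  push Not at hbig hcon
  obtain ⟨V, hV, hVj⟩ := hV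
  have hVj' : Module.finrank ℝ V = j := le_antisymm (Nat.lt_succ_iff.1 (hbig V hV)) hVj
  obtain ⟨V', hV', hdim, hlimV⟩ := hV.exists_limit ht0 hlim
  have hdisc := hV.exists_discrete fun W hW => by
    have := hbig W hW; omega
  have hdisc' := hV'.exists_discrete fun W hW => by
    have := hcon W hW; omega
  obtain ⟨T, -, hT⟩ := Finset.exists_subset_card_eq
    (s := (Finset.univ : Finset (Fin m ⊕ Fin n))) (n := j) (by simpa using hj1.le)
  obtain ⟨α, hα, hαV⟩ := exists_adapted_basis g V hdisc T (hT.trans hVj'.symm)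
  obtain ⟨β, hβ, hβV⟩ := exists_adapted_basis g' V' hdisc' T (by omega)
  -- The adapted basis of `g' ℤ^d` is approximated by bases of `h_t g ℤ^d`; were a basis vector in
  -- the limit subspace approximated by lattice points outside `h_t V`, the dimension would grow.
  have hev : ∀ i ∈ T, ∀ᶠ k in l,
      act (g * intSL (δ k)) (fun a => (β a i : ℝ)) ∈ V := by
    intro i hi
    obtain ⟨σ, hσV, hσ⟩ := hlimV _ (hβV i hi)
    have hmem : ∀ k, act (g * intSL (δ k)) (fun a => (β a i : ℝ)) - σ k ∈
        V.toAddSubgroup ⊔ lattice g := fun k =>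
      sub_mem (AddSubgroup.mem_sup_right
        (lattice_mul_intSL_le g (δ k) (mem_lattice.2 ⟨fun a => β a i, rfl⟩)))
        (AddSubgroup.mem_sup_left (hσV k))
    have h0 : Tendsto (fun k => act (flow m n (t k))
        (act (g * intSL (δ k)) (fun a => (β a i : ℝ)) - σ k)) l (𝓝 0) := by
      have h1 := (((continuous_act fun a => (β a i : ℝ)).tendsto g').comp hlim).sub hσ
      rw [sub_self] at h1
      refine h1.congr fun k => ?_
      rw [map_sub, ← act_mul, ← mul_assoc]
      rfl
    by_contra hnot
    have hnot' : ∀ᶠ k in l, act (g * intSL (δ k)) (fun a => (β a i : ℝ)) - σ k ∉ V := by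
      filter_upwards [Ultrafilter.eventually_not.2 hnot] with k hk hk'
      exact hk (by simpa using V.add_mem hk' (hσV k))
    obtain ⟨W, hW, hWdim⟩ := hV.exists_finrank_succ ht0 hlim (.of_forall hmem) hnot' h0
    have := hcon W hW
    omega
  set P : Matrix (Fin m ⊕ Fin n) (Fin m ⊕ Fin n) ℝ :=
    Subtype.val g * α.map (Int.castRingHom ℝ) with hP
  have hdetmap : ∀ M : Matrix (Fin m ⊕ Fin n) (Fin m ⊕ Fin n) ℤ, IsUnit M.det →
      (M.map (Int.castRingHom ℝ)).det ≠ 0 := fun M hM => by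
    rw [← RingHom.mapMatrix_apply, ← RingHom.map_det]
    exact (hM.map (Int.castRingHom ℝ)).ne_zero
  have hPdet : P.det ≠ 0 := by
    rw [hP, Matrix.det_mul, g.2, one_mul]
    exact hdetmap α hα
  set B : Matrix (Fin m ⊕ Fin n) (Fin m ⊕ Fin n) ℝ :=
    Subtype.val g' * β.map (Int.castRingHom ℝ) with hB
  have hBdet : B.det ≠ 0 := by
    rw [hB, Matrix.det_mul, g'.2, one_mul]
    exact hdetmap β hβ
  -- the change of basis from the adapted basis of `g ℤ^d` to the one approximating that of `g' ℤ^d`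
  let D : κ → Matrix (Fin m ⊕ Fin n) (Fin m ⊕ Fin n) ℤ := fun k => α⁻¹ * (δ k).1 * β
  have hPD : ∀ k, P * (D k).map (Int.castRingHom ℝ)
      = Subtype.val (g * intSL (δ k)) * β.map (Int.castRingHom ℝ) := fun k => by
    have h1 : α * D k = (δ k).1 * β := by
      simp only [D, mul_assoc]
      rw [Matrix.mul_nonsing_inv_cancel_left _ _ hα]
    rw [hP, mul_assoc, ← Matrix.map_mul, h1, Matrix.map_mul, ← mul_assoc]
    rfl
  have hne : Nonempty (Fin m ⊕ Fin n) := (Finset.card_pos.1 (hT ▸ hj0)).to_type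
  let b : Module.Basis (Fin m ⊕ Fin n) ℝ (Fin m ⊕ Fin n → ℝ) :=
    basisOfLinearIndependentOfCardEqFinrank (Matrix.linearIndependent_cols_of_det_ne_zero hPdet)
      (by simp)
  have hbP : ∀ i, b i = fun a => P a i := fun i => by
    simp only [b, coe_basisOfLinearIndependentOfCardEqFinrank]
    rfl
  refine not_tendsto_of_block_triangular hmn ht P B hBdet D T (hT ▸ hj0) (hT ▸ hj1)
    (.of_forall fun k => ?_) ?_ ?_
  · simp only [D, Matrix.det_mul, (δ k).2, mul_one]
    exact (Matrix.isUnit_nonsing_inv_det _ hα).mul hβ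
  · have hall := (Filter.eventually_all_finset T).2 hev
    filter_upwards [hall] with k hk i hi a ha
    have hx : act (g * intSL (δ k)) (fun a => (β a i : ℝ)) = ∑ a, (D k a i : ℝ) • b a := by
      ext c
      have := congrFun (congrFun (hPD k) c) i
      rw [Matrix.mul_apply, Matrix.mul_apply] at this
      rw [act_apply, Matrix.mulVec, dotProduct, Finset.sum_apply]
      simp only [hbP, Pi.smul_apply, smul_eq_mul]
      refine Eq.trans this.symm (Finset.sum_congr rfl fun x _ => ?_)
      rw [mul_comm]
      rfl
    have hz := basis_repr_eq_zero_of_mem b V T (hT.trans hVj'.symm) (fun i hi => by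
      rw [hbP]
      exact hαV i hi) (hx ▸ hk i hi) ha
    rw [b.repr_sum_self] at hz
    exact_mod_cast hz
  · have hcont : Continuous fun M : G m n => Subtype.val M * β.map (Int.castRingHom ℝ) :=
      continuous_subtype_val.matrix_mul continuous_const
    refine ((hcont.tendsto g').comp hlim).congr fun k => ?_
    rw [mul_assoc _ P, hPD, ← mul_assoc]
    exact congrArg (fun M : G m n => Subtype.val M * β.map (Int.castRingHom ℝ))
      (mul_assoc (flow m n (t k)) g (intSL (δ k)))

/-- Accumulation points of orbits in the space of lattices, lifted to `SL_d(ℝ)`. -/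
theorem exists_ultrafilter_of_mem_asymptoticAcc {g g' : G m n}
    (h : (QuotientGroup.mk g' : LatticeSpace m n) ∈ asymptoticAcc (QuotientGroup.mk g)) :
    ∃ l : Ultrafilter (ℝ × SpecialLinearGroup (Fin m ⊕ Fin n) ℤ),
      Tendsto Prod.fst (l : Filter (ℝ × SpecialLinearGroup (Fin m ⊕ Fin n) ℤ)) atTop ∧
      Tendsto (fun k : ℝ × SpecialLinearGroup (Fin m ⊕ Fin n) ℤ =>
        flow m n k.1 * g * intSL k.2) l (𝓝 g') := by
  obtain ⟨t, -, htb, htlim⟩ := h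
  let Φ : ℝ × SpecialLinearGroup (Fin m ⊕ Fin n) ℤ → G m n := fun k =>
    flow m n k.1 * g * intSL k.2
  have key : ∀ T : ℝ, ∀ O ∈ 𝓝 g', ∃ k, T ≤ k.1 ∧ Φ k ∈ O := by
    intro T O hO
    have hO' : (QuotientGroup.mk '' O : Set (LatticeSpace m n)) ∈ 𝓝 (QuotientGroup.mk g') :=
      QuotientGroup.isOpenMap_coe.image_mem_nhds hO
    obtain ⟨K, hK⟩ := eventually_atTop.1 (htlim.eventually hO')
    obtain ⟨k, hkK, hkT⟩ : ∃ k ≥ K, T ≤ t k := by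
      by_contra! hcon
      apply htb
      have : Set.range t ⊆ t '' Set.Iio K ∪ Set.Iic T := by
        rintro _ ⟨k, rfl⟩
        rcases lt_or_ge k K with hk | hk
        · exact .inl ⟨k, hk, rfl⟩
        · exact .inr (hcon k hk).le
      exact (((Set.finite_Iio K).image t).bddAbove.union bddAbove_Iic).mono this
    obtain ⟨o, ho, hok⟩ := hK k hkK
    obtain ⟨γ, hγ⟩ := QuotientGroup.eq.1 (hok.symm :
      (QuotientGroup.mk (flow m n (t k) * g) : LatticeSpace m n) = QuotientGroup.mk o)
    refine ⟨(t k, γ), hkT, ?_⟩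
    have : Φ (t k, γ) = o := by
      change flow m n (t k) * g * intSL γ = o
      rw [show intSL γ = (flow m n (t k) * g)⁻¹ * o from hγ, mul_inv_cancel_left]
    rwa [this]
  have hne : (comap Prod.fst atTop ⊓ comap Φ (𝓝 g')).NeBot := by
    rw [inf_neBot_iff]
    rintro s ⟨S, hS, hSs⟩ s' ⟨O, hO, hOs⟩
    obtain ⟨T, hT⟩ := mem_atTop_sets.1 hS
    obtain ⟨k, hk1, hk2⟩ := key T O hO
    exact ⟨k, hSs (hT _ hk1), hOs hk2⟩
  have hle := Ultrafilter.of_le (comap Prod.fst atTop ⊓ comap Φ (𝓝 g'))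
  exact ⟨Ultrafilter.of _, tendsto_comap.mono_left (hle.trans inf_le_left),
    tendsto_comap.mono_left (hle.trans inf_le_right)⟩

/-- The line of a vector `u` of the expanded space `ℝ^m` is approximable at every accumulation
point of the orbit. -/
theorem approximable_span_singleton (hn : 1 ≤ n) {g₀ g' : G m n} (u : Fin m → ℝ)
    {l : Ultrafilter (ℝ × SpecialLinearGroup (Fin m ⊕ Fin n) ℤ)}
    (ht : Tendsto Prod.fst (l : Filter (ℝ × SpecialLinearGroup (Fin m ⊕ Fin n) ℤ)) atTop)
    (hlim : Tendsto (fun k : ℝ × SpecialLinearGroup (Fin m ⊕ Fin n) ℤ =>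
      flow m n k.1 * g₀ * intSL k.2) l (𝓝 g')) :
    Approximable g₀ (Sum.elim u 0) g'
      (Submodule.span ℝ {(Sum.elim u 0 : Fin m ⊕ Fin n → ℝ)}) := by
  intro F hF hFS O hO r hr ε hε T
  have hdec : ∀ s : F, ∃ a : ℝ, a • (Sum.elim u 0 : Fin m ⊕ Fin n → ℝ) = s.1 := fun s =>
    Submodule.mem_span_singleton.1 (hFS s.2)
  choose a ha using hdec
  have : Finite F := hF
  have hsmall : ∀ s : F, ∀ᶠ k : ℝ × SpecialLinearGroup (Fin m ⊕ Fin n) ℤ in l,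
      |Real.exp (-(n * k.1)) * a s| ≤ r := fun s => by
    have h1 : Tendsto (fun k : ℝ × SpecialLinearGroup (Fin m ⊕ Fin n) ℤ =>
        Real.exp (-(n * k.1)) * a s) l (𝓝 0) := by
      have := (Real.tendsto_exp_neg_atTop_nhds_zero.comp
        (ht.const_mul_atTop (Nat.cast_pos.2 hn : (0 : ℝ) < n))).mul_const (a s)
      simpa using! this
    have h2 := h1.abs
    rw [abs_zero] at h2
    exact h2.eventually (Iic_mem_nhds hr)
  obtain ⟨k, hk1, hk2, hk3⟩ := ((ht.eventually_ge_atTop T).and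
    ((hlim.eventually_mem hO).and (eventually_all.2 hsmall))).exists
  refine ⟨k.1, hk1, ⟨k.2, hk2⟩, fun s hs => ⟨_, hk3 ⟨s, hs⟩, 0, zero_mem _, ?_⟩⟩
  have : act (flow m n k.1) ((Real.exp (-(n * k.1)) * a ⟨s, hs⟩) •
      (Sum.elim u 0 : Fin m ⊕ Fin n → ℝ) + 0) = s := by
    refine Eq.trans ?_ (ha ⟨s, hs⟩)
    rw [add_zero]
    ext (i | i)
    · rw [act_flow_inl]
      simp only [Pi.smul_apply, Sum.elim_inl, smul_eq_mul, ← mul_assoc, ← Real.exp_add]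
      simp
    · rw [act_flow_inr]
      simp
  rw [this, sub_self, norm_zero]
  exact hε.le

/-- If `A` is not `k`-divergent for `k ≤ d - 2`, then every direction in `ℝ^m` generates an
approximable subspace of codimension at most one at some lattice. -/
theorem exists_approximable_hyperplane (hm : 1 ≤ m) (hn : 1 ≤ n) (hmn : Nat.gcd m n = 1)
    (A : Matrix (Fin m) (Fin n) ℝ)
    (hA : ∀ k : ℕ, k + 2 ≤ m + n → ¬ MatrixIsKDivergent A (k : ℕ∞)) (u : Fin m → ℝ)
    (hu : u ≠ 0) :
    ∃ (g : G m n) (V : Submodule ℝ (Fin m ⊕ Fin n → ℝ)),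
      Approximable (unip A) (Sum.elim u 0) g V ∧ m + n ≤ Module.finrank ℝ V + 1 := by
  obtain ⟨j, I, hI, hj⟩ : ∃ (j : ℕ) (I : Fin (j + 1) → LatticeSpace m n),
      IsAccSeq (latticeOf A) I ∧ m + n ≤ j + 1 := by
    by_contra! hcon
    set S := {l : ℕ∞ | ∃ (j : ℕ) (I : Fin (j + 1) → LatticeSpace m n),
      IsAccSeq (latticeOf A) I ∧ l = j} with hS
    have hle : sSup S ≤ ((m + n - 2 : ℕ) : ℕ∞) := sSup_le (by
      rintro _ ⟨j, I, hI, rfl⟩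
      have := hcon j I hI
      exact Nat.cast_le.2 (by omega))
    obtain ⟨k, hk⟩ := ENat.ne_top_iff_exists.1 (ne_top_of_le_ne_top (ENat.natCast_ne_top _) hle)
    rw [← hk, Nat.cast_le] at hle
    exact hA k (by omega) hk
  have key : ∀ i : ℕ, ∀ hi : i < j, i + 1 < m + n → ∀ g' : G m n,
      QuotientGroup.mk g' = I ⟨i + 1, by omega⟩ →
      ∃ V : Submodule ℝ (Fin m ⊕ Fin n → ℝ),
        Approximable (unip A) (Sum.elim u 0) g' V ∧ i + 1 ≤ Module.finrank ℝ V := by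
    intro i
    induction i with
    | zero =>
      intro hi _ g' hg'
      have hacc := hI.2 ⟨0, hi⟩
      have h0 : I (Fin.castSucc ⟨0, hi⟩) = QuotientGroup.mk (unip A) := hI.1
      rw [h0, show Fin.succ ⟨0, hi⟩ = (⟨0 + 1, by omega⟩ : Fin (j + 1)) from rfl, ← hg'] at hacc
      obtain ⟨l, hl1, hl2⟩ := exists_ultrafilter_of_mem_asymptoticAcc hacc
      refine ⟨_, approximable_span_singleton hn u hl1 hl2, ?_⟩
      rw [finrank_span_singleton]
      intro h
      exact hu (funext fun i => congrFun h (Sum.inl i))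
    | succ i ih =>
      intro hi hid g' hg'
      obtain ⟨g, hg⟩ := QuotientGroup.mk_surjective (I ⟨i + 1, by omega⟩)
      have hacc := hI.2 ⟨i + 1, hi⟩
      rw [show Fin.castSucc ⟨i + 1, hi⟩ = (⟨i + 1, by omega⟩ : Fin (j + 1)) from rfl, ← hg,
        show Fin.succ ⟨i + 1, hi⟩ = (⟨i + 1 + 1, by omega⟩ : Fin (j + 1)) from rfl,
        ← hg'] at hacc
      obtain ⟨l, hl1, hl2⟩ := exists_ultrafilter_of_mem_asymptoticAcc hacc
      exact Approximable.exists_finrank_gt hmn hl1 hl2 (Nat.succ_pos i) (by omega)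
        (ih (by omega) (by omega) g hg)
  obtain ⟨g, hg⟩ := QuotientGroup.mk_surjective (I ⟨m + n - 2 + 1, by omega⟩)
  obtain ⟨V, hV, hdim⟩ := key (m + n - 2) (by omega) (by omega) g hg
  exact ⟨g, V, hV, by omega⟩

/-! ### Good approximations from an approximable hyperplane -/

theorem continuous_seminorm {k : ℕ} (N : Seminorm ℝ (Fin k → ℝ)) : Continuous N :=
  N.convexOn.locallyLipschitz.continuous

/-- The points `(x, y) ∈ ℝ^m × ℝ^n` with `‖y‖ > δ` and `‖y‖^{n/m} ‖x‖ < c`. -/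
def cusp (Nm : Seminorm ℝ (Fin m → ℝ)) (Nn : Seminorm ℝ (Fin n → ℝ)) (c δ : ℝ) :
    Set (Fin m ⊕ Fin n → ℝ) :=
  {x | δ < Nn (fun i => x (Sum.inr i)) ∧
    Nn (fun i => x (Sum.inr i)) ^ ((n : ℝ) / m) * Nm (fun i => x (Sum.inl i)) < c}

theorem isOpen_cusp (Nm : Seminorm ℝ (Fin m → ℝ)) (Nn : Seminorm ℝ (Fin n → ℝ)) (c δ : ℝ) :
    IsOpen (cusp Nm Nn c δ) := by
  have h1 : Continuous fun x : Fin m ⊕ Fin n → ℝ => Nn (fun i => x (Sum.inr i)) :=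
    (continuous_seminorm Nn).comp (by fun_prop)
  have h2 : Continuous fun x : Fin m ⊕ Fin n → ℝ => Nm (fun i => x (Sum.inl i)) :=
    (continuous_seminorm Nm).comp (by fun_prop)
  exact (isOpen_lt continuous_const h1).inter
    (isOpen_lt ((h1.rpow_const fun _ => .inr (by positivity)).mul h2) continuous_const)

theorem cusp_anti (Nm : Seminorm ℝ (Fin m → ℝ)) (Nn : Seminorm ℝ (Fin n → ℝ)) (c : ℝ) {δ δ' : ℝ}
    (h : δ ≤ δ') : cusp Nm Nn c δ' ⊆ cusp Nm Nn c δ := fun _ hx => ⟨h.trans_lt hx.1, hx.2⟩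

theorem exists_ker_le (hn : 1 ≤ n) (V : Submodule ℝ (Fin m ⊕ Fin n → ℝ))
    (hV : m + n ≤ Module.finrank ℝ V + 1) :
    ∃ f : (Fin m ⊕ Fin n → ℝ) →ₗ[ℝ] ℝ, f ≠ 0 ∧ LinearMap.ker f ≤ V := by
  by_cases hVt : V = ⊤
  · refine ⟨LinearMap.proj (Sum.inr ⟨0, hn⟩), fun h => ?_, hVt ▸ le_top⟩
    have := LinearMap.congr_fun h 1
    simp at this
  · obtain ⟨f, hf, hVf⟩ := V.exists_le_ker_of_lt_top (lt_top_iff_ne_top.2 hVt)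
    refine ⟨f, hf, (Submodule.eq_of_le_of_finrank_le hVf ?_).ge⟩
    have h1 := f.finrank_range_add_finrank_ker
    rw [LinearMap.range_eq_top.2 (LinearMap.surjective hf), finrank_top] at h1
    simp at h1
    omega

/-- Every translate of a hyperplane together with a lattice meets every `cusp`: if the hyperplane
contains `ℝ^n`, one lets the `ℝ^n`-component tend to `0`; otherwise one chooses a parallel
hyperplane off the origin and a point in `ℝ^n` on it. -/
theorem exists_add_mem_cusp (hm : 1 ≤ m) (hn : 1 ≤ n)
    (Nm : Seminorm ℝ (Fin m → ℝ)) (Nn : Seminorm ℝ (Fin n → ℝ)) (hNn : ∀ v, Nn v = 0 → v = 0)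
    (g : G m n) (V : Submodule ℝ (Fin m ⊕ Fin n → ℝ)) (hV : m + n ≤ Module.finrank ℝ V + 1)
    {c : ℝ} (hc : 0 < c) (z : Fin m ⊕ Fin n → ℝ) :
    ∃ s ∈ V.toAddSubgroup ⊔ lattice g, z + s ∈ cusp Nm Nn c 0 := by
  obtain ⟨f, hf, hfV⟩ := exists_ker_le hn V hV
  have hNpos : ∀ v, v ≠ 0 → 0 < Nn v := fun v hv =>
    (apply_nonneg Nn v).lt_of_ne' fun h => hv (hNn v h)
  have hexp : 0 < (n : ℝ) / m := div_pos (Nat.cast_pos.2 hn) (Nat.cast_pos.2 hm)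
  -- distinguish whether the hyperplane `ker f` contains `ℝ^n`
  by_cases hw : ∃ w : Fin n → ℝ, f (Sum.elim 0 w) ≠ 0
  · obtain ⟨w, hw⟩ := hw
    obtain ⟨v, hv, hfv⟩ : ∃ v ∈ lattice g, f (z + v) ≠ 0 := by
      by_cases hz : f z = 0
      · by_contra! hcon
        apply hf
        have hle : Submodule.span ℝ (Set.range (latticeMap g)) ≤ LinearMap.ker f := by
          rw [Submodule.span_le]
          rintro _ ⟨y, rfl⟩
          have := hcon _ (mem_lattice.2 ⟨y, rfl⟩)
          rw [map_add, hz, zero_add] at this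
          exact this
        rw [span_range_latticeMap] at hle
        exact LinearMap.ker_eq_top.1 (top_le_iff.1 hle)
      · exact ⟨0, zero_mem _, by simpa using hz⟩
    set x : Fin m ⊕ Fin n → ℝ := Sum.elim 0 ((f (z + v) / f (Sum.elim 0 w)) • w) with hx
    have hxw : x = (f (z + v) / f (Sum.elim 0 w)) • (Sum.elim 0 w : Fin m ⊕ Fin n → ℝ) := by
      ext (i | i) <;> simp [hx]
    refine ⟨x - z, ?_, ?_⟩
    · have h1 : x - (z + v) ∈ V := hfV (by
        rw [LinearMap.mem_ker, map_sub, hxw, map_smul, smul_eq_mul, div_mul_cancel₀ _ hw, sub_self])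
      have h2 : x - z = (x - (z + v)) + v := by abel
      rw [h2]
      exact AddSubgroup.add_mem_sup h1 hv
    · have hw0 : w ≠ 0 := by
        rintro rfl
        have h0 : (Sum.elim 0 0 : Fin m ⊕ Fin n → ℝ) = 0 := by ext (i | i) <;> rfl
        exact hw (by rw [h0, map_zero])
      rw [add_sub_cancel]
      refine ⟨hNpos _ (smul_ne_zero (div_ne_zero hfv hw) hw0), ?_⟩
      have : (fun i => x (Sum.inl i)) = 0 := rfl
      rw [this, map_zero, mul_zero]
      exact hc
  · push Not at hw
    have : Nonempty (Fin n) := ⟨⟨0, hn⟩⟩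
    let y : ℝ → (Fin n → ℝ) := fun ε _ => ε
    have hcont : Continuous fun ε : ℝ => Nn (y ε) ^ ((n : ℝ) / m) * Nm (fun i => z (Sum.inl i)) :=
      ((((continuous_seminorm Nn).comp (by fun_prop)).rpow_const
        fun _ => .inr hexp.le)).mul continuous_const
    have h0 : Nn (y 0) ^ ((n : ℝ) / m) * Nm (fun i => z (Sum.inl i)) = 0 := by
      have : y 0 = 0 := rfl
      rw [this, map_zero, Real.zero_rpow hexp.ne', zero_mul]
    have hev : ∀ᶠ ε in 𝓝 (0 : ℝ),
        Nn (y ε) ^ ((n : ℝ) / m) * Nm (fun i => z (Sum.inl i)) < c :=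
      hcont.continuousAt.eventually_lt continuousAt_const (h0.trans_lt hc)
    obtain ⟨ε, hε, hεpos⟩ := ((hev.filter_mono nhdsWithin_le_nhds).and
      (self_mem_nhdsWithin : Set.Ioi (0 : ℝ) ∈ 𝓝[>] 0)).exists
    have hy : y ε ≠ 0 := fun h => (ne_of_gt hεpos) (congrFun h ⟨0, hn⟩)
    set x : Fin m ⊕ Fin n → ℝ := Sum.elim (fun i => z (Sum.inl i)) (y ε) with hx
    refine ⟨x - z, AddSubgroup.mem_sup_left (hfV ?_), ?_⟩
    · have : x - z = (Sum.elim 0 fun i => x (Sum.inr i) - z (Sum.inr i) : Fin m ⊕ Fin n → ℝ) := by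
        ext (i | i) <;> simp [hx]
      rw [LinearMap.mem_ker, this]
      exact hw _
    · rw [add_sub_cancel]
      exact ⟨hNpos _ hy, hε⟩

/-- On a bounded set, finitely many elements of `V + g ℤ^d` suffice to reach the cusp, with a
uniform margin. -/
theorem exists_finite_cusp (hm : 1 ≤ m) (hn : 1 ≤ n)
    (Nm : Seminorm ℝ (Fin m → ℝ)) (Nn : Seminorm ℝ (Fin n → ℝ)) (hNn : ∀ v, Nn v = 0 → v = 0)
    (g : G m n) (V : Submodule ℝ (Fin m ⊕ Fin n → ℝ)) (hV : m + n ≤ Module.finrank ℝ V + 1)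
    {c : ℝ} (hc : 0 < c) (R : ℝ) :
    ∃ F : Set (Fin m ⊕ Fin n → ℝ), F.Finite ∧
      F ⊆ (V.toAddSubgroup ⊔ lattice g : AddSubgroup (Fin m ⊕ Fin n → ℝ)) ∧
      ∃ ε > 0, ∃ δ > 0, ∀ z ∈ Metric.closedBall (0 : Fin m ⊕ Fin n → ℝ) R, ∃ s ∈ F, ∀ y,
        ‖y - (z + s)‖ ≤ ε → y ∈ cusp Nm Nn c δ := by
  refine (isCompact_closedBall (0 : Fin m ⊕ Fin n → ℝ) R).induction_on
    (p := fun K => ∃ F : Set (Fin m ⊕ Fin n → ℝ), F.Finite ∧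
      F ⊆ (V.toAddSubgroup ⊔ lattice g : AddSubgroup (Fin m ⊕ Fin n → ℝ)) ∧
      ∃ ε > 0, ∃ δ > 0, ∀ z ∈ K, ∃ s ∈ F, ∀ y, ‖y - (z + s)‖ ≤ ε → y ∈ cusp Nm Nn c δ)
    ?_ ?_ ?_ ?_
  · exact ⟨∅, Set.finite_empty, by simp, 1, one_pos, 1, one_pos, by simp⟩
  · rintro K K' hK ⟨F, hF, hFS, ε, hε, δ, hδ, h⟩
    exact ⟨F, hF, hFS, ε, hε, δ, hδ, fun z hz => h z (hK hz)⟩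
  · rintro K K' ⟨F, hF, hFS, ε, hε, δ, hδ, h⟩ ⟨F', hF', hFS', ε', hε', δ', hδ', h'⟩
    refine ⟨F ∪ F', hF.union hF', Set.union_subset hFS hFS', min ε ε', lt_min hε hε', min δ δ',
      lt_min hδ hδ', ?_⟩
    rintro z (hz | hz)
    · obtain ⟨s, hs, hy⟩ := h z hz
      exact ⟨s, .inl hs, fun y hyz =>
        cusp_anti _ _ _ (min_le_left _ _) (hy y (hyz.trans (min_le_left _ _)))⟩
    · obtain ⟨s, hs, hy⟩ := h' z hz
      exact ⟨s, .inr hs, fun y hyz =>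
        cusp_anti _ _ _ (min_le_right _ _) (hy y (hyz.trans (min_le_right _ _)))⟩
  · intro z _
    obtain ⟨s, hs, hzs⟩ := exists_add_mem_cusp hm hn Nm Nn hNn g V hV hc z
    obtain ⟨δ, hδ0, hδ⟩ := exists_between hzs.1
    obtain ⟨ε, hε, hball⟩ := Metric.isOpen_iff.1 (isOpen_cusp Nm Nn c δ) (z + s) ⟨hδ, hzs.2⟩
    refine ⟨Metric.ball z (ε / 2),
      mem_nhdsWithin_of_mem_nhds (Metric.ball_mem_nhds z (by positivity)), {s},
      Set.finite_singleton s, by simpa using hs, ε / 3, by positivity, δ, hδ0, ?_⟩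
    intro z' hz'
    refine ⟨s, rfl, fun y hy => hball ?_⟩
    rw [mem_ball_iff_norm] at hz' ⊢
    have : y - (z + s) = (y - (z' + s)) + (z' - z) := by abel
    rw [this]
    linarith [norm_add_le (y - (z' + s)) (z' - z)]

/-- Lattices near `g ℤ^d` are uniformly relatively dense. -/
theorem exists_nhds_relatively_dense (g : G m n) : ∃ O ∈ 𝓝 g, ∃ R : ℝ, ∀ g' ∈ O, ∀ z,
    ∃ v ∈ lattice g', z - v ∈ Metric.closedBall (0 : Fin m ⊕ Fin n → ℝ) R := by
  let b : (Fin m ⊕ Fin n) → (Fin m ⊕ Fin n → ℝ) := fun i => Pi.single i 1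
  refine ⟨⋂ i, {g' | ‖act g' (b i)‖ < ‖act g (b i)‖ + 1}, iInter_mem.2 fun i => ?_,
    ∑ i, (‖act g (b i)‖ + 1), fun g' hg' z => ?_⟩
  · exact (isOpen_lt (continuous_act _).norm continuous_const).mem_nhds (by simp)
  · set a := act g'⁻¹ z with ha
    refine ⟨act g' (fun i => ((⌊a i⌋ : ℤ) : ℝ)), mem_lattice.2 ⟨_, rfl⟩, ?_⟩
    have hz : z = act g' a := by rw [ha, ← act_mul, mul_inv_cancel, act_one]
    have h1 : z - act g' (fun i => ((⌊a i⌋ : ℤ) : ℝ)) = ∑ i, Int.fract (a i) • act g' (b i) := by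
      rw [hz, ← map_sub]
      simp only [← map_smul, ← map_sum]
      congr 1
      ext j
      simp [b, Finset.sum_apply, Pi.single_apply]
    rw [mem_closedBall_zero_iff, h1]
    refine (norm_sum_le _ _).trans (Finset.sum_le_sum fun i _ => ?_)
    rw [norm_smul, Real.norm_eq_abs, abs_of_nonneg (Int.fract_nonneg _)]
    have h2 := Set.mem_iInter.1 hg' i
    rw [Set.mem_ofPred_eq] at h2
    have h3 := (Int.fract_lt_one (a i)).le
    nlinarith [norm_nonneg (act g' (b i)), Int.fract_nonneg (a i)]

/-! ### The torus -/

theorem toTorus_add (v w : Fin m → ℝ) : toTorus (v + w) = toTorus v + toTorus w := by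
  ext i; simp [toTorus]

theorem toTorus_sub (v w : Fin m → ℝ) : toTorus (v - w) = toTorus v - toTorus w := by
  ext i; simp [toTorus]

theorem toTorus_intVec (p : Fin m → ℤ) : toTorus (intVec p) = 0 := by
  ext i
  simp only [toTorus, intVec, Pi.zero_apply]
  exact (AddCircle.coe_eq_zero_iff 1).2 ⟨p i, by simp⟩

theorem continuous_toTorus : Continuous (toTorus : (Fin m → ℝ) → UnitAddTorus (Fin m)) :=
  continuous_pi fun i => (AddCircle.continuous_mk' 1).comp (continuous_apply i)

theorem isOpenMap_toTorus : IsOpenMap (toTorus : (Fin m → ℝ) → UnitAddTorus (Fin m)) :=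
  IsOpenMap.piMap (fun _ => QuotientAddGroup.isOpenMap_coe) (by simp)

theorem torusDist_toTorus_le (N : Seminorm ℝ (Fin m → ℝ)) (v : Fin m → ℝ) :
    torusDist N (toTorus v) ≤ N v :=
  csInf_le ⟨0, by rintro _ ⟨w, -, rfl⟩; exact apply_nonneg N w⟩ ⟨v, rfl, rfl⟩

theorem measurable_torusDist (N : Seminorm ℝ (Fin m → ℝ)) : Measurable (torusDist N) := by
  refine measurable_of_Iio fun a => ?_
  have : torusDist N ⁻¹' Set.Iio a = toTorus '' {v | N v < a} := by
    ext x
    have hsurj : ∃ v : Fin m → ℝ, toTorus v = x := by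
      choose v hv using fun i => QuotientAddGroup.mk_surjective (x i)
      exact ⟨v, funext hv⟩
    obtain ⟨v₀, hv₀⟩ := hsurj
    have hbdd : BddBelow (N '' {v | toTorus v = x}) :=
      ⟨0, by rintro _ ⟨w, -, rfl⟩; exact apply_nonneg N w⟩
    have hne : (N '' {v | toTorus v = x}).Nonempty := ⟨_, v₀, hv₀, rfl⟩
    rw [Set.mem_preimage, Set.mem_Iio, torusDist, csInf_lt_iff hbdd hne]
    constructor
    · rintro ⟨_, ⟨v, hv, rfl⟩, hlt⟩
      exact ⟨v, hlt, hv⟩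
    · rintro ⟨v, hlt, hv⟩
      exact ⟨_, ⟨v, hv, rfl⟩, hlt⟩
  rw [this]
  exact (isOpenMap_toTorus _
    (isOpen_lt (continuous_seminorm N) continuous_const)).measurableSet

/-- The targets which are not approximated better than `c ‖q‖^{-n/m}` by any `q` with
`‖q‖ ≥ Q`. -/
def farSet (Nm : Seminorm ℝ (Fin m → ℝ)) (Nn : Seminorm ℝ (Fin n → ℝ))
    (A : Matrix (Fin m) (Fin n) ℝ) (c Q : ℝ) : Set (UnitAddTorus (Fin m)) :=
  ⋂ q : Fin n → ℤ, {η | Q ≤ Nn (intVec q) → c ≤ Nn (intVec q) ^ ((n : ℝ) / (m : ℝ)) *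
    torusDist Nm (toTorus (A.mulVec (intVec q)) - η)}

theorem measurableSet_farSet (Nm : Seminorm ℝ (Fin m → ℝ)) (Nn : Seminorm ℝ (Fin n → ℝ))
    (A : Matrix (Fin m) (Fin n) ℝ) (c Q : ℝ) : MeasurableSet (farSet Nm Nn A c Q) := by
  refine MeasurableSet.iInter fun q => MeasurableSet.imp (.const _) ?_
  exact measurableSet_le measurable_const
    (((measurable_torusDist Nm).comp (measurable_const.sub measurable_id)).const_mul _)

theorem exists_mem_farSet (Nm : Seminorm ℝ (Fin m → ℝ)) (Nn : Seminorm ℝ (Fin n → ℝ))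
    (A : Matrix (Fin m) (Fin n) ℝ) {η : UnitAddTorus (Fin m)} (h : 0 < approxLiminf Nm Nn A η) :
    ∃ k l : ℕ, η ∈ farSet Nm Nn A (1 / ((k : ℝ) + 1)) l := by
  obtain ⟨c, hc0, hc⟩ := exists_between h
  have hev := eventually_lt_of_lt_liminf hc
  obtain ⟨S, hS, hSsub⟩ := hev
  obtain ⟨Q, hQ⟩ := mem_atTop_sets.1 hS
  obtain ⟨l, hl⟩ := exists_nat_ge Q
  have hcpos : 0 < c.toReal := ENNReal.toReal_pos hc0.ne' (ne_top_of_lt hc)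
  obtain ⟨k, hk⟩ := exists_nat_one_div_lt hcpos
  refine ⟨k, l, Set.mem_iInter.2 fun q hq => ?_⟩
  have h1 : c < ENNReal.ofReal _ := hSsub (hQ _ (hl.trans hq))
  exact hk.le.trans ((ENNReal.lt_ofReal_iff_toReal_lt (ne_top_of_lt hc)).1 h1).le

/-! ### Null sets of badly approximable targets -/

theorem act_unip_inl (A : Matrix (Fin m) (Fin n) ℝ) (x : Fin m ⊕ Fin n → ℝ) (i : Fin m) :
    act (unip A) x (Sum.inl i) = x (Sum.inl i) + (A *ᵥ fun j => x (Sum.inr j)) i := by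
  change (Matrix.fromBlocks 1 A 0 1 *ᵥ x) (Sum.inl i) = _
  rw [Matrix.fromBlocks_mulVec]
  simp [Function.comp_def]

theorem act_unip_inr (A : Matrix (Fin m) (Fin n) ℝ) (x : Fin m ⊕ Fin n → ℝ) (i : Fin n) :
    act (unip A) x (Sum.inr i) = x (Sum.inr i) := by
  change (Matrix.fromBlocks 1 A 0 1 *ᵥ x) (Sum.inr i) = _
  rw [Matrix.fromBlocks_mulVec]
  simp [Function.comp_def]

/-- A grid point moved into the cusp at a late time is a good approximation; `‖y‖^{n/m} ‖x‖` is
invariant under the flow. -/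
theorem notMem_farSet_of_mem_cusp (hm : 1 ≤ m) (Nm : Seminorm ℝ (Fin m → ℝ))
    (Nn : Seminorm ℝ (Fin n → ℝ)) (A : Matrix (Fin m) (Fin n) ℝ) {c δ Q t : ℝ}
    (hQ : Q ≤ Real.exp (m * t) * δ) (ξ : Fin m → ℝ) {v : Fin m ⊕ Fin n → ℝ}
    (hv : v ∈ lattice (unip A))
    (hc : act (flow m n t) (v - Sum.elim ξ 0) ∈ cusp Nm Nn c δ) :
    toTorus ξ ∉ farSet Nm Nn A c Q := by
  intro hfar
  obtain ⟨z, rfl⟩ := mem_lattice.1 hv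
  set q : Fin n → ℤ := fun i => z (Sum.inr i) with hq
  set p : Fin m → ℤ := fun i => z (Sum.inl i) with hp
  have hl : (fun i => act (flow m n t) (act (unip A) (fun i => (z i : ℝ)) - Sum.elim ξ 0)
      (Sum.inl i)) = Real.exp (n * t) • (A *ᵥ intVec q - ξ + intVec p) := by
    ext i
    rw [act_flow_inl, Pi.sub_apply, act_unip_inl]
    simp only [Sum.elim_inl, Pi.smul_apply, Pi.add_apply, Pi.sub_apply, smul_eq_mul]
    have h1 : (fun j => (z (Sum.inr j) : ℝ)) = intVec q := rfl
    have h2 : (z (Sum.inl i) : ℝ) = intVec p i := rfl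
    rw [h1, h2]
    ring
  have hr : (fun i => act (flow m n t) (act (unip A) (fun i => (z i : ℝ)) - Sum.elim ξ 0)
      (Sum.inr i)) = Real.exp (-(m * t)) • intVec q := by
    ext i
    rw [act_flow_inr, Pi.sub_apply, act_unip_inr]
    simp [intVec, hq]
  obtain ⟨h1, h2⟩ := hc
  rw [hr, map_smul_eq_mul, Real.norm_eq_abs, Real.abs_exp] at h1 h2
  rw [hl, map_smul_eq_mul, Real.norm_eq_abs, Real.abs_exp] at h2
  have hQq : Q ≤ Nn (intVec q) := by
    refine hQ.trans ?_
    have h3 := mul_le_mul_of_nonneg_left h1.le (Real.exp_pos (m * t)).le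
    rwa [← mul_assoc, ← Real.exp_add, add_neg_cancel, Real.exp_zero, one_mul] at h3
  have hlow := Set.mem_iInter.1 hfar q hQq
  have htor : toTorus (A *ᵥ intVec q - ξ + intVec p) = toTorus (A *ᵥ intVec q) - toTorus ξ := by
    rw [toTorus_add, toTorus_sub, toTorus_intVec, add_zero]
  have hdist := torusDist_toTorus_le Nm (A *ᵥ intVec q - ξ + intVec p)
  rw [htor] at hdist
  have hm' : (m : ℝ) ≠ 0 := Nat.cast_ne_zero.2 (by omega)
  rw [Real.mul_rpow (Real.exp_pos _).le (apply_nonneg _ _), ← Real.exp_mul] at h2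
  have hexp : Real.exp (-(m * t) * (n / m)) * Real.exp (n * t) = 1 := by
    rw [← Real.exp_add, Real.exp_eq_one_iff]
    field_simp
    ring
  have h4 : Real.exp (-(m * t) * (n / m)) * Nn (intVec q) ^ ((n : ℝ) / m) *
      (Real.exp (n * t) * Nm (A *ᵥ intVec q - ξ + intVec p))
      = Nn (intVec q) ^ ((n : ℝ) / m) * Nm (A *ᵥ intVec q - ξ + intVec p) := by
    calc _ = (Real.exp (-(m * t) * (n / m)) * Real.exp (n * t)) *
          (Nn (intVec q) ^ ((n : ℝ) / m) * Nm (A *ᵥ intVec q - ξ + intVec p)) := by ring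
      _ = _ := by rw [hexp, one_mul]
  rw [h4] at h2
  have h5 := mul_le_mul_of_nonneg_left hdist
    (Real.rpow_nonneg (apply_nonneg Nn (intVec q)) ((n : ℝ) / m))
  linarith

/-- At every scale `r`, translations by boundedly many numbers in `[-r, r]` suffice to move every
point of a line in direction `u` out of `farSet`. -/
theorem exists_translates_notMem_farSet (hm : 1 ≤ m) (hn : 1 ≤ n)
    (Nm : Seminorm ℝ (Fin m → ℝ)) (Nn : Seminorm ℝ (Fin n → ℝ)) (hNn : ∀ v, Nn v = 0 → v = 0)
    (A : Matrix (Fin m) (Fin n) ℝ) {u : Fin m → ℝ} {g : G m n}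
    {V : Submodule ℝ (Fin m ⊕ Fin n → ℝ)} (hV : Approximable (unip A) (Sum.elim u 0) g V)
    (hdim : m + n ≤ Module.finrank ℝ V + 1) (η : Fin m → ℝ) {c : ℝ} (hc : 0 < c) (Q : ℝ) :
    ∃ N : ℕ, ∀ r > 0, ∃ a : Fin N → ℝ, (∀ i, |a i| ≤ r) ∧
      ∀ τ : ℝ, ∃ i, toTorus ((τ - a i) • u + η) ∉ farSet Nm Nn A c Q := by
  obtain ⟨O, hO, R, hR⟩ := exists_nhds_relatively_dense g
  obtain ⟨F, hF, hFS, ε, hε, δ, hδ, hcusp⟩ := exists_finite_cusp hm hn Nm Nn hNn g V hdim hc R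
  have := hF.fintype
  refine ⟨Fintype.card F, fun r hr => ?_⟩
  have hT : ∀ᶠ t : ℝ in atTop, Q ≤ Real.exp (m * t) * δ :=
    ((Real.tendsto_exp_atTop.comp (tendsto_id.const_mul_atTop
      (Nat.cast_pos.2 hm : (0 : ℝ) < m))).atTop_mul_const hδ).eventually_ge_atTop Q
  obtain ⟨T, hT⟩ := eventually_atTop.1 hT
  obtain ⟨t, htT, ⟨γ, hγ⟩, happ⟩ := hV.sup_lattice F hF hFS O hO r hr ε hε T
  choose a ha w hw haw using fun s : F => happ s s.2
  refine ⟨a ∘ (Fintype.equivFin F).symm, fun i => ha _, fun τ => ?_⟩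
  obtain ⟨v, hv, hz⟩ := hR _ hγ (act (flow m n t) (-Sum.elim (τ • u + η) 0))
  obtain ⟨s, hs, hball⟩ := hcusp _ hz
  obtain ⟨y, hy, rfl⟩ : ∃ y ∈ lattice (unip A), act (flow m n t) y = v := by
    obtain ⟨ζ, hζ⟩ := mem_lattice.1 (lattice_mul_intSL_le _ γ hv)
    exact ⟨act (unip A) fun i => (ζ i : ℝ), mem_lattice.2 ⟨ζ, rfl⟩, by rw [← act_mul, hζ]⟩
  refine ⟨Fintype.equivFin F ⟨s, hs⟩, ?_⟩
  simp only [Function.comp_apply, Equiv.symm_apply_apply]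
  refine notMem_farSet_of_mem_cusp hm Nm Nn A (hT t htT) _ (sub_mem (hw ⟨s, hs⟩) hy)
    (hball _ ?_)
  have e1 : w ⟨s, hs⟩ - y - (Sum.elim ((τ - a ⟨s, hs⟩) • u + η) 0 : Fin m ⊕ Fin n → ℝ)
      = -(Sum.elim (τ • u + η) 0 : Fin m ⊕ Fin n → ℝ) - y
        + (a ⟨s, hs⟩ • (Sum.elim u 0 : Fin m ⊕ Fin n → ℝ) + w ⟨s, hs⟩) := by
    ext (i | i)
    · simp
      ring
    · simp
      ring
  have e2 : ∀ x y z s : Fin m ⊕ Fin n → ℝ, x - y + z - (x - y + s) = z - s :=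
    fun _ _ _ _ => by abel
  rw [e1, map_add, map_sub, e2]
  exact haw ⟨s, hs⟩

/-- A measurable set of reals whose complement meets, at every scale, one of boundedly many small
translates of every point is null, by the Lebesgue density theorem. -/
theorem ae_notMem_of_translates {E : Set ℝ} (hE : MeasurableSet E) {N : ℕ}
    (h : ∀ r > 0, ∃ a : Fin N → ℝ, (∀ i, |a i| ≤ r) ∧ ∀ τ : ℝ, ∃ i, τ - a i ∉ E) :
    ∀ᵐ τ : ℝ, τ ∉ E := by
  filter_upwards [Besicovitch.ae_tendsto_measure_inter_div_of_measurableSet volume hE.compl]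
    with x hx hxE
  have hind : (Eᶜ).indicator (1 : ℝ → ℝ≥0∞) x = 0 := Set.indicator_of_notMem (by simpa using hxE) _
  rw [hind] at hx
  have hlow : ∀ ρ > 0, ENNReal.ofReal ρ ≤ N * volume (Eᶜ ∩ Metric.closedBall x ρ) := by
    intro ρ hρ
    obtain ⟨a, ha, hcov⟩ := h (ρ / 2) (by positivity)
    have hsub : Metric.closedBall x (ρ / 2) ⊆
        ⋃ i, (fun τ => τ - a i) ⁻¹' (Eᶜ ∩ Metric.closedBall x ρ) := by
      intro τ hτ
      obtain ⟨i, hi⟩ := hcov τ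
      refine Set.mem_iUnion.2 ⟨i, hi, ?_⟩
      rw [Metric.mem_closedBall, Real.dist_eq] at hτ ⊢
      have h1 := ha i
      rw [abs_le] at hτ h1 ⊢
      constructor <;> linarith
    calc ENNReal.ofReal ρ = volume (Metric.closedBall x (ρ / 2)) := by
          rw [Real.volume_closedBall]; congr 1; ring
      _ ≤ ∑ i, volume ((fun τ => τ - a i) ⁻¹' (Eᶜ ∩ Metric.closedBall x ρ)) :=
          (measure_mono hsub).trans (measure_iUnion_fintype_le _ _)
      _ = N * volume (Eᶜ ∩ Metric.closedBall x ρ) := by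
          have hpre : ∀ i, volume ((fun τ => τ - a i) ⁻¹' (Eᶜ ∩ Metric.closedBall x ρ))
              = volume (Eᶜ ∩ Metric.closedBall x ρ) := fun i =>
            (measurePreserving_sub_right volume (a i)).measure_preimage
              (hE.compl.inter measurableSet_closedBall).nullMeasurableSet
          simp only [hpre, Finset.sum_const, Finset.card_univ, Fintype.card_fin, nsmul_eq_mul]
  have hlim := ENNReal.Tendsto.const_mul (a := 2 * (N : ℝ≥0∞)) hx
    (.inr (ENNReal.mul_ne_top ENNReal.ofNat_ne_top (ENNReal.natCast_ne_top N)))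
  rw [mul_zero] at hlim
  have hge : ∀ᶠ ρ : ℝ in 𝓝[>] 0, 1 ≤ 2 * (N : ℝ≥0∞) *
      (volume (Eᶜ ∩ Metric.closedBall x ρ) / volume (Metric.closedBall x ρ)) := by
    filter_upwards [self_mem_nhdsWithin] with ρ hρ
    have hρ' : (0 : ℝ) < ρ := hρ
    have h2 : volume (Metric.closedBall x ρ) = 2 * ENNReal.ofReal ρ := by
      rw [Real.volume_closedBall, ENNReal.ofReal_mul zero_le_two, ENNReal.ofReal_ofNat]
    rw [h2, ← mul_div_assoc, mul_assoc,
      ENNReal.mul_div_mul_left _ _ two_ne_zero ENNReal.ofNat_ne_top,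
      ENNReal.le_div_iff_mul_le (.inl (by simpa using hρ')) (.inl ENNReal.ofReal_ne_top), one_mul]
    exact hlow ρ hρ'
  exact absurd (ge_of_tendsto hlim hge) (by simp)

theorem ae_notMem_farSet (hm : 1 ≤ m) (hn : 1 ≤ n) (hmn : Nat.gcd m n = 1)
    (Nm : Seminorm ℝ (Fin m → ℝ)) (Nn : Seminorm ℝ (Fin n → ℝ)) (hNn : ∀ v, Nn v = 0 → v = 0)
    (A : Matrix (Fin m) (Fin n) ℝ)
    (hA : ∀ k : ℕ, k + 2 ≤ m + n → ¬ MatrixIsKDivergent A (k : ℕ∞)) {u : Fin m → ℝ}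
    (hu : u ≠ 0) (η : Fin m → ℝ) {c : ℝ} (hc : 0 < c) (Q : ℝ) :
    ∀ᵐ τ : ℝ, toTorus (τ • u + η) ∉ farSet Nm Nn A c Q := by
  obtain ⟨g, V, hV, hdim⟩ := exists_approximable_hyperplane hm hn hmn A hA u hu
  obtain ⟨N, hN⟩ := exists_translates_notMem_farSet hm hn Nm Nn hNn A hV hdim η hc Q
  refine ae_notMem_of_translates (E := {τ | toTorus (τ • u + η) ∈ farSet Nm Nn A c Q}) ?_ hN
  exact (continuous_toTorus.comp
    (by fun_prop : Continuous fun τ : ℝ => τ • u + η)).measurable (measurableSet_farSet _ _ _ _ _)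

/-- A set that meets every line in direction `u` in a null set of parameters is null for every
probability measure invariant under translations in direction `u`, by Fubini. -/
theorem measure_eq_zero_of_invariant (μ : Measure (UnitAddTorus (Fin m))) [IsProbabilityMeasure μ]
    {u : Fin m → ℝ} (hμ : ∀ τ : ℝ, Measure.map (fun y => toTorus (τ • u) + y) μ = μ)
    {E : Set (UnitAddTorus (Fin m))} (hE : MeasurableSet E)
    (h : ∀ η : Fin m → ℝ, ∀ᵐ τ : ℝ, toTorus (τ • u + η) ∉ E) : μ E = 0 := by
  have hcont : Continuous fun p : UnitAddTorus (Fin m) × ℝ => toTorus (p.2 • u) + p.1 :=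
    (continuous_toTorus.comp (by fun_prop)).add continuous_fst
  have hP := hcont.measurable hE
  have h1 : (μ.prod volume) ((fun p : UnitAddTorus (Fin m) × ℝ => toTorus (p.2 • u) + p.1) ⁻¹' E)
      = 0 := by
    rw [Measure.measure_prod_null hP]
    refine .of_forall fun x => ?_
    choose v hv using fun i => QuotientAddGroup.mk_surjective (x i)
    have hvx : toTorus v = x := funext hv
    have h2 := h v
    rw [ae_iff] at h2
    simpa [toTorus_add, hvx, Set.preimage] using h2
  have h3 := Measure.ae_ae_of_ae_prod (measure_eq_zero_iff_ae_notMem.1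
    ((Measure.measurePreserving_swap (μ := (volume : Measure ℝ)) (ν := μ)).measure_preimage
      hP.nullMeasurableSet |>.trans h1))
  obtain ⟨τ, hτ⟩ := h3.exists
  have h4 : μ ((fun y => toTorus (τ • u) + y) ⁻¹' E) = 0 := measure_eq_zero_iff_ae_notMem.2 hτ
  rw [← hμ τ, Measure.map_apply (measurable_const_add _) hE, h4]

end InhomApprox

end

theorem mainTheorem2 (m n : ℕ) (hm : 1 ≤ m) (hn : 1 ≤ n) (hmn : Nat.gcd m n = 1)
    (Nm : Seminorm ℝ (Fin m → ℝ)) (hNm : ∀ v, Nm v = 0 → v = 0)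
    (Nn : Seminorm ℝ (Fin n → ℝ)) (hNn : ∀ v, Nn v = 0 → v = 0)
    (A : Matrix (Fin m) (Fin n) ℝ)
    (hA : ∀ k : ℕ, k + 2 ≤ m + n → ¬ InhomApprox.MatrixIsKDivergent A (k : ℕ∞)) :
    (∀ μ : Measure (UnitAddTorus (Fin m)), InhomApprox.IsNontrivialAlgebraic μ →
      μ (InhomApprox.Bad Nm Nn A) = 0) ∧
    (∀ (p₀ : Fin m → ℤ), p₀ ≠ 0 → ∀ η : Fin m → ℝ, ∀ᵐ t : ℝ,
      InhomApprox.approxLiminf Nm Nn A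
        (InhomApprox.toTorus (t • InhomApprox.intVec p₀ + η)) = 0) := by
  constructor
  · rintro μ ⟨hprob, U, hU, -, hinv, -⟩
    obtain ⟨u, huU, hu⟩ := (Submodule.ne_bot_iff U).1 hU
    have hsub : InhomApprox.Bad Nm Nn A ⊆
        ⋃ k : ℕ, ⋃ l : ℕ, InhomApprox.farSet Nm Nn A (1 / ((k : ℝ) + 1)) l := fun η hη => by
      obtain ⟨k, l, h⟩ := InhomApprox.exists_mem_farSet Nm Nn A hη
      exact Set.mem_iUnion.2 ⟨k, Set.mem_iUnion.2 ⟨l, h⟩⟩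
    refine measure_mono_null hsub (measure_iUnion_null fun k => measure_iUnion_null fun l => ?_)
    exact InhomApprox.measure_eq_zero_of_invariant μ (fun τ => hinv _ (U.smul_mem τ huU))
      (InhomApprox.measurableSet_farSet _ _ _ _ _) fun η =>
        InhomApprox.ae_notMem_farSet hm hn hmn Nm Nn hNn A hA hu η (by positivity) l
  · intro p₀ hp₀ η
    have hu : InhomApprox.intVec p₀ ≠ 0 := fun h => hp₀ (funext fun i => by
      have := congrFun h i
      simpa [InhomApprox.intVec] using this)
    have hae : ∀ᵐ t : ℝ, ∀ k l : ℕ, InhomApprox.toTorus (t • InhomApprox.intVec p₀ + η) ∉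
        InhomApprox.farSet Nm Nn A (1 / ((k : ℝ) + 1)) l :=
      ae_all_iff.2 fun k => ae_all_iff.2 fun l =>
        InhomApprox.ae_notMem_farSet hm hn hmn Nm Nn hNn A hA hu η (by positivity) l
    filter_upwards [hae] with t ht
    by_contra hne
    obtain ⟨k, l, h⟩ := InhomApprox.exists_mem_farSet Nm Nn A (pos_iff_ne_zero.2 hne)
    exact ht k l h
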